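/- Let $n\ge 1$ and let $\Gamma_n$ be a Coxeter graph with vertices $x_1,\dots,x_n$ and Coxeter matrix $(m_{ij})$, and let $\Gamma_{n-1}$ be the full Coxeter subgraph on $x_1,\dots,x_{n-1}$ (the same labels $m_{ij}$, empty if $n=1$). Assume that both graphs are of spherical type, i.e. that their Coxeter groups are finite. For a Coxeter graph $\Gamma$ let $\mathcal M(\Gamma)$ be its Artin monoid, generated by the vertices with the relations $x_ix_jx_i\cdots=x_jx_ix_j\cdots$ ($m_{ij}$ factors on each side) for all $i,j$ with $m_{ij}\neq\infty$. In a monoid write $a\mid b$ if $b=\lambda a\rho$ for some $\lambda,\rho$, write $a\mid_L b$ if $b=a\rho$ for some $\rho$, and $a\mid_R b$ if $b=\lambda a$ for some $\lambda$. The Garside element $\Delta(\Gamma)\in\mathcal M(\Gamma)$ is the element such that every generator satisfies $x_i\mid_L\Delta(\Gamma)$, and such that $\Delta(\Gamma)\mid_L\omega$ whenever $\omega\in\mathcal M(\Gamma)$ satisfies $x_i\mid_L\omega$ for every generator $x_i$. Then $\Delta(\Gamma_{n-1})$ and $\Delta(\Gamma_n)$ exist and are unique. Moreover, with $\Delta(\Gamma_{n-1})$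 regarded as an element of $\mathcal M(\Gamma_n)$ through the homomorphism $x_i\mapsto x_i$, there is a unique $R_n\in\mathcal M(\Gamma_n)$ (the relative Garside element) with $\Delta(\Gamma_n)=\Delta(\Gamma_{n-1})R_n$, and there is a unique permutation $\sigma_n$ of $\{1,\dots,n\}$ with $x_i\Delta(\Gamma_n)=\Delta(\Gamma_n)x_{\sigma_n(i)}$ for all $i$. They satisfy: a) $R_n$ is square-free: there is no generator $x_i$ with $x_i^2\mid R_n$; b) for $1\le i\le n$: $x_i\mid_L R_n$ if and only if $i=n$; c) there is a bijection $\sigma:\{1,\dots,n-1\}\to\{1,\dots,n\}\setminus\{\sigma_n(n)\}$ such that $x_iR_n=R_nx_{\sigma(i)}$ for all $i\in\{1,\dots,n-1\}$; d) for $1\le j\le n$: $x_j\mid_R R_n$ if and only if $j=\sigma_n(n)$. -/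

import Mathlib

/-- The full Coxeter subgraph of `M` on the vertices in the image of an injection `f`. -/
def CoxeterMatrix.restrict {B' B : Type*} (M : CoxeterMatrix B) (f : B' ↪ B) :
    CoxeterMatrix B' where
  M i j := M (f i) (f j)
  isSymm := Matrix.IsSymm.ext fun i j => M.symmetric (f j) (f i)
  diagonal i := M.diagonal (f i)
  off_diagonal i j h := M.off_diagonal (f i) (f j) (fun e => h (f.injective e))

/-- The defining relations of the Artin monoid: for all vertices `s`, `t` with `m s t ≠ ∞`
(Mathlib encodes `∞` by `0`), the two alternating words in `s` and `t` with `m s t` letters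
are identified. -/
def CoxeterMatrix.artinRel {B : Type*} (M : CoxeterMatrix B) (a b : FreeMonoid B) : Prop :=
  ∃ s t : B, M s t ≠ 0 ∧
    a = FreeMonoid.ofList (CoxeterSystem.alternatingWord s t (M s t)) ∧
    b = FreeMonoid.ofList (CoxeterSystem.alternatingWord t s (M s t))

/-- The Artin monoid of a Coxeter graph. -/
abbrev ArtinMonoid {B : Type*} (M : CoxeterMatrix B) : Type _ :=
  PresentedMonoid M.artinRel

namespace ArtinMonoid

/-- The standard generators. -/
def gen {B : Type*} (M : CoxeterMatrix B) (i : B) : ArtinMonoid M :=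
  PresentedMonoid.of M.artinRel i

theorem map_alternatingWord {B' B : Type*} (f : B' → B) (i j : B') (m : ℕ) :
    (CoxeterSystem.alternatingWord i j m).map f =
      CoxeterSystem.alternatingWord (f i) (f j) m := by
  induction m generalizing i j with
  | zero => rfl
  | succ m ih => simp [CoxeterSystem.alternatingWord_succ, ih]

theorem lift_gen_ofList {B' B : Type*} (M : CoxeterMatrix B) (f : B' → B) (l : List B') :
    FreeMonoid.lift (fun i => gen M (f i)) (FreeMonoid.ofList l) =
      PresentedMonoid.mk M.artinRel (FreeMonoid.ofList (l.map f)) := by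
  induction l with
  | nil => simp
  | cons a l ih =>
    rw [FreeMonoid.ofList_cons, map_mul, ih, List.map_cons, FreeMonoid.ofList_cons, map_mul]
    rfl

/-- The homomorphism of Artin monoids induced by the inclusion of a full Coxeter subgraph;
it sends the generator of a vertex `i` to the generator of `f i`. -/
def incl {B' B : Type*} (M : CoxeterMatrix B) (f : B' ↪ B) :
    ArtinMonoid (M.restrict f) →* ArtinMonoid M :=
  PresentedMonoid.lift (fun i => gen M (f i)) (by
    rintro _ _ ⟨s, t, h, rfl, rfl⟩
    rw [lift_gen_ofList, lift_gen_ofList, map_alternatingWord, map_alternatingWord]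
    exact PresentedMonoid.mk_eq_mk_of_rel ⟨f s, f t, h, rfl, rfl⟩)

theorem incl_gen {B' B : Type*} (M : CoxeterMatrix B) (f : B' ↪ B) (i : B') :
    incl M f (gen (M.restrict f) i) = gen M (f i) := rfl

/-- `a` is a left divisor of `b`. -/
def LeftDvd {N : Type*} [Monoid N] (a b : N) : Prop := ∃ r, b = a * r

/-- `a` is a right divisor of `b`. -/
def RightDvd {N : Type*} [Monoid N] (a b : N) : Prop := ∃ l, b = l * a

/-- `a` divides `b` (as a factor in any position). -/
def FactorDvd {N : Type*} [Monoid N] (a b : N) : Prop := ∃ l r, b = l * a * r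

/-- No square of a generator divides `u`. -/
def IsSquareFree {B : Type*} {M : CoxeterMatrix B} (u : ArtinMonoid M) : Prop :=
  ∀ i : B, ¬ FactorDvd (gen M i ^ 2) u

/-- `D` is a Garside element: the least common multiple of the generators
with respect to left divisibility. -/
def IsGarsideElement {B : Type*} {M : CoxeterMatrix B} (D : ArtinMonoid M) : Prop :=
  (∀ i : B, LeftDvd (gen M i) D) ∧
    ∀ w : ArtinMonoid M, (∀ i : B, LeftDvd (gen M i) w) → LeftDvd D w

end ArtinMonoid

/-! Write Δ for the Garside element of the whole graph, E for the image of that of the subgraph, and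
Δ = E R. Three facts give everything: Artin monoids are left cancellative, Δ is square-free, and
conjugation by a Garside element permutes the generators. Since E ends in every `x_i` with `i < n`,
a factor `x_i` at the front of R would put `x_i²` into Δ; so R can only start with `x_n`, and it
does start with something because Δ involves `x_n` and E does not. Combining the two conjugations
and cancelling E gives `x_i R = R x_j`, with j running over all indices except `σ_n(n)`; moving a
letter of E through R excludes every other last letter by the same square argument.

The three facts come from the section `simpleLift` of the projection to the Coxeter group W, defined
by reduced words and well defined by Matsumoto's theorem. Its values are square-free, and Δ is the
value at the longest element. For cancellation and the least common multiple property, induction on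
length shows that each equality `x_i a = x_j b` comes from a common simple left divisor of both
sides (`simpleLcmsUpTo`); the engine is that simple left divisors form a directed set
(`SimpleLcmsUpTo.directed`).

On the side of W this needs the exchange condition, the exact order of `s_i s_j`, and the
preservation of reduced words under inclusion of a full subgraph (`isReduced_map`). -/

namespace CoxeterMatrix

/-! ### The geometric representation and the order of a product of two simple reflections. -/

open Module Polynomial.Chebyshev

variable {B : Type*} (M : CoxeterMatrix B)

/-- The entries `2 ⟨αᵢ, αⱼ⟩` of the canonical bilinear form of a Coxeter matrix. -/
noncomputable def cartan (i j : B) : ℝ := -2 * Real.cos (Real.pi / M i j)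

/-- The simple root attached to a vertex in the geometric representation. -/
noncomputable def root (i : B) : B →₀ ℝ := Finsupp.single i 1

/-- The simple coroot attached to a vertex in the geometric representation. -/
noncomputable def coroot (i : B) : Dual ℝ (B →₀ ℝ) := Finsupp.linearCombination ℝ (M.cartan i)

theorem coroot_root (i j : B) : M.coroot i (root j) = M.cartan i j := by
  simp [coroot, root]

theorem coroot_root_self (i : B) : M.coroot i (root i) = 2 := by
  simp [coroot_root, cartan]

theorem cartan_symm (i j : B) : M.cartan i j = M.cartan j i := by
  simp [cartan, M.symmetric i j]

/-- The simple reflections of the geometric representation. -/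
noncomputable def geomReflection (i : B) : (B →₀ ℝ) ≃ₗ[ℝ] (B →₀ ℝ) :=
  reflection (M.coroot_root_self i)

/-- On the plane of two roots the product of the reflections has trace `2 cos θ`, `θ = 2π/m`; its
powers are then Chebyshev polynomials `S` evaluated at this number. -/
theorem trace_eq (i j : B) :
    2 * Real.cos (2 * (Real.pi / M i j)) =
      M.coroot i (root j) * M.coroot j (root i) - 2 := by
  rw [coroot_root, coroot_root, M.cartan_symm j i, cartan, Real.cos_two_mul]
  ring

theorem sin_two_pi_div_pos {m : ℕ} (hm : 2 < m) : 0 < Real.sin (2 * (Real.pi / m)) := by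
  have h : (2 : ℝ) < m := by exact_mod_cast hm
  apply Real.sin_pos_of_pos_of_lt_pi
  · have := Real.pi_pos
    positivity
  · rw [← mul_div_assoc, div_lt_iff₀ (by linarith)]
    nlinarith [Real.pi_pos]

/-- For `m > 2` the coefficients of the power `m` vanish because `S_n(2 cos θ) sin θ = sin((n+1)θ)`
and `mθ = 2π`. For `m = 2`, `sin θ = 0` and the power is computed directly; `m = 0` encodes ∞ and
asks nothing. -/
theorem isLiftable_geomReflection : M.IsLiftable M.geomReflection := by
  intro i j
  rcases eq_or_ne i j with rfl | hij
  · rw [M.diagonal, pow_one]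
    ext1 x
    exact involutive_reflection (M.coroot_root_self i) x
  obtain hm | hm | hm : M i j = 0 ∨ M i j = 2 ∨ 2 < M i j := by
    have := M.off_diagonal i j hij
    omega
  · simp [hm]
  · ext1 z
    rw [geomReflection, geomReflection,
      reflection_mul_reflection_pow_apply _ _ _ _ _ (M.trace_eq i j)]
    have hm' : M j i = 2 := (M.symmetric j i).trans hm
    simp only [coroot_root, cartan, hm, hm']
    have e1 : ((2 : ℕ) - 1 : ℤ) / 2 = 0 := by norm_num
    have e2 : ((2 : ℕ) - 3 : ℤ) / 2 = -1 := by norm_num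
    have e3 : ((2 : ℕ) - 2 : ℤ) / 2 = 0 := by norm_num
    have e4 : ((2 : ℕ) : ℤ) / 2 = 1 := by norm_num
    have e5 : 2 * (Real.pi / ((2 : ℕ) : ℝ)) = Real.pi := by push_cast; ring
    rw [e1, e2, e3, e4, e5]
    simp
    module
  · have hs := sin_two_pi_div_pos hm
    set θ := 2 * (Real.pi / M i j) with hθ
    have hmθ : M i j * θ = 2 * Real.pi := by
      have : (M i j : ℝ) ≠ 0 := by positivity
      rw [hθ]
      field_simp
    have key : ∀ n : ℤ, (S ℝ n).eval (2 * Real.cos θ) * Real.sin θ = Real.sin ((n + 1) * θ) :=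
      fun n => S_two_mul_real_cos θ n
    ext1 z
    rw [geomReflection, geomReflection,
      reflection_mul_reflection_pow_apply _ _ _ _ _ (M.trace_eq i j)]
    rcases Nat.even_or_odd' (M i j) with ⟨k, hk | hk⟩
    · have e1 : ((M i j : ℕ) - 1 : ℤ) / 2 = k - 1 := by omega
      have e3 : ((M i j : ℕ) - 2 : ℤ) / 2 = k - 1 := by omega
      have h0 : (S ℝ ((k : ℤ) - 1)).eval (2 * Real.cos θ) = 0 := by
        have h1 := key (k - 1)
        have h2 : (((k : ℤ) - 1 : ℤ) + 1 : ℝ) * θ = Real.pi := by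
          rw [hk] at hmθ
          push_cast at hmθ ⊢
          linarith
        rw [h2, Real.sin_pi] at h1
        exact (mul_eq_zero.1 h1).resolve_right hs.ne'
      rw [e1, e3, h0]
      simp
    · have e1 : ((M i j : ℕ) - 1 : ℤ) / 2 = k := by omega
      have e2 : ((M i j : ℕ) : ℤ) / 2 = k := by omega
      have e3 : ((M i j : ℕ) - 2 : ℤ) / 2 = k - 1 := by omega
      have e4 : ((M i j : ℕ) - 3 : ℤ) / 2 = k - 1 := by omega
      have h0 : (S ℝ (k : ℤ)).eval (2 * Real.cos θ) +
          (S ℝ ((k : ℤ) - 1)).eval (2 * Real.cos θ) = 0 := by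
        have h1 := key (k - 1)
        have h2 := key k
        have h3 : ((k : ℤ) + 1 : ℝ) * θ = 2 * Real.pi - (((k : ℤ) - 1 : ℤ) + 1 : ℝ) * θ := by
          rw [hk] at hmθ
          push_cast at hmθ ⊢
          linarith
        rw [h3, Real.sin_two_pi_sub, ← h1] at h2
        refine (mul_eq_zero.1 (?_ : _ * Real.sin θ = 0)).resolve_right hs.ne'
        linarith
      rw [e1, e2, e3, e4, h0]
      simp

/-- Apply the power to `root i` and read off both coordinates. For `m > 2` they give `sin kθ = 0`
and `cos kθ = 1`, so `kθ` is a multiple of 2π; for `m = ∞` the second coordinate grows linearly in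
`k`. -/
theorem dvd_of_geomReflection_pow_eq_one {i j : B} (hij : i ≠ j) {k : ℕ}
    (h : (M.geomReflection i * M.geomReflection j) ^ k = 1) : M i j ∣ k := by
  have h1 := reflection_mul_reflection_pow_apply_self (M.coroot_root_self i)
    (M.coroot_root_self j) k _ (M.trace_eq i j)
  change ((M.geomReflection i * M.geomReflection j) ^ k) (root i) = _ at h1
  rw [h] at h1
  have hx := DFunLike.congr_fun h1 i
  have hy := DFunLike.congr_fun h1 j
  simp only [LinearEquiv.coe_one, id, root, Finsupp.coe_add, Finsupp.coe_smul, Pi.add_apply,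
    Pi.smul_apply, Finsupp.single_eq_same, Finsupp.single_eq_of_ne hij, smul_eq_mul,
    Finsupp.single_eq_of_ne hij.symm, mul_one, mul_zero, add_zero, zero_add] at hx hy
  have hc : M.coroot j (Finsupp.single i 1) = M.cartan i j := by
    rw [M.cartan_symm i j, ← coroot_root, root]
  rw [hc] at hy
  set θ := 2 * (Real.pi / M i j) with hθ
  obtain hm | hm | hm : M i j = 0 ∨ M i j = 2 ∨ 2 < M i j := by
    have := M.off_diagonal i j hij
    omega
  · have : θ = 0 := by simp [hθ, hm]
    rw [this, Real.cos_zero, mul_one, S_eval_two] at hy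
    simp [cartan, hm] at hy
    simp [hm, hy]
  · have : θ = Real.pi := by simp [hθ, hm]; ring
    rw [this, Real.cos_pi, mul_neg, mul_one, S_eval_neg_two, S_eval_neg_two] at hx
    rw [hm]
    rcases Nat.even_or_odd k with hk | hk
    · exact hk.two_dvd
    · exfalso
      have hk' : Odd (k : ℤ) := by exact_mod_cast hk
      have hk2 : Even ((k : ℤ) - 1) := hk'.sub_odd odd_one
      rw [Int.negOnePow_odd _ hk', Int.negOnePow_even _ hk2] at hx
      push_cast at hx
      linarith
  · have hs := sin_two_pi_div_pos hm
    rw [← hθ] at hs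
    have hcart : M.cartan i j ≠ 0 := by
      have h2 : (2 : ℝ) < M i j := by exact_mod_cast hm
      have : 0 < Real.cos (Real.pi / M i j) := by
        apply Real.cos_pos_of_mem_Ioo
        constructor
        · have : 0 < Real.pi / M i j := by positivity
          linarith [Real.pi_pos]
        · exact div_lt_div_of_pos_left Real.pi_pos two_pos h2
      rw [cartan]
      simp [this.ne']
    have hS0 : (S ℝ ((k : ℤ) - 1)).eval (2 * Real.cos θ) = 0 := by
      rcases mul_eq_zero.1 hy.symm with h | h
      · exact h
      · exact absurd (neg_eq_zero.1 h) hcart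
    rw [hS0, add_zero] at hx
    have k1 := S_two_mul_real_cos θ k
    have k2 := S_two_mul_real_cos θ ((k : ℤ) - 1)
    rw [← hx, one_mul] at k1
    rw [hS0, zero_mul] at k2
    push_cast at k1 k2
    rw [sub_add_cancel] at k2
    rw [add_mul, one_mul, Real.sin_add, ← k2, zero_mul, zero_add] at k1
    have hcos : Real.cos (k * θ) = 1 := by
      have : (Real.cos (k * θ) - 1) * Real.sin θ = 0 := by linarith
      have := (mul_eq_zero.1 this).resolve_right hs.ne'
      linarith
    obtain ⟨n, hn⟩ := (Real.cos_eq_one_iff _).1 hcos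
    have hm0 : (M i j : ℝ) ≠ 0 := by positivity
    have : (n * M i j : ℝ) = k := by
      rw [hθ] at hn
      field_simp at hn
      linarith
    have h3 : (M i j : ℤ) ∣ k := ⟨n, by rw [mul_comm]; exact_mod_cast this.symm⟩
    exact_mod_cast h3

end CoxeterMatrix

/-! ### Parity of inversions and the exchange condition. -/

namespace CoxeterSystem

variable {B W : Type*} [Group W] {M : CoxeterMatrix B} (cs : CoxeterSystem M W)

theorem dvd_of_simple_mul_simple_pow_eq_one {i j : B} (hij : i ≠ j) {k : ℕ}
    (h : (cs.simple i * cs.simple j) ^ k = 1) : M i j ∣ k := by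
  apply M.dvd_of_geomReflection_pow_eq_one hij
  have := congrArg (cs.lift ⟨M.geomReflection, M.isLiftable_geomReflection⟩) h
  simpa using this

theorem simple_injective : Function.Injective cs.simple := by
  intro i j h
  by_contra hij
  have := cs.dvd_of_simple_mul_simple_pow_eq_one hij (k := 1) (by simp [h])
  exact M.off_diagonal i j hij (Nat.dvd_one.1 this)

theorem alternatingWord_two_mul_succ (i j : B) (m : ℕ) :
    alternatingWord i j (2 * (m + 1)) = i :: j :: alternatingWord i j (2 * m) := by
  rw [show 2 * (m + 1) = 2 * m + 1 + 1 by ring, alternatingWord_succ', alternatingWord_succ']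
  simp

theorem reverse_alternatingWord_two_mul (i j : B) (m : ℕ) :
    (alternatingWord i j (2 * m)).reverse = alternatingWord j i (2 * m) := by
  induction m with
  | zero => rfl
  | succ m ih =>
    rw [alternatingWord_two_mul_succ, List.reverse_cons, List.reverse_cons, ih,
      show 2 * (m + 1) = 2 * m + 1 + 1 by ring, alternatingWord_succ, alternatingWord_succ]
    simp

theorem wordProd_alternatingWord_odd (i j : B) (k : ℕ) :
    cs.wordProd (alternatingWord j i (2 * k + 1)) =
      cs.simple i * (cs.simple j * cs.simple i) ^ k := by
  rw [prod_alternatingWord_eq_mul_pow, if_neg (by simp), show (2 * k + 1) / 2 = k by omega]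

theorem leftInvSeq_alternatingWord_two_mul (i j : B) (p : ℕ) :
    cs.leftInvSeq (alternatingWord i j (2 * p)) =
      (List.range (2 * p)).map fun k => cs.simple i * (cs.simple j * cs.simple i) ^ k := by
  refine List.ext_getElem (by simp) fun k h1 h2 => ?_
  rw [getElem_leftInvSeq_alternatingWord _ _ _ _ _ (by simpa using h1),
    wordProd_alternatingWord_odd]
  simp

-- The inversion sequence of a word of length `2m` is periodic with period `m`, so it is one list
-- repeated twice.
open Classical in
theorem even_count_leftInvSeq_alternatingWord (i j : B) (t : W) :
    Even ((cs.leftInvSeq (alternatingWord i j (2 * M i j))).count t) := by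
  rw [leftInvSeq_alternatingWord_two_mul, two_mul, List.range_add, List.map_append, List.map_map]
  have : ((fun k => cs.simple i * (cs.simple j * cs.simple i) ^ k) ∘ fun x => M i j + x) =
      fun k => cs.simple i * (cs.simple j * cs.simple i) ^ k := by
    funext k
    simp [pow_add]
  rw [this, List.count_append]
  exact ⟨_, rfl⟩

open Classical in
/-- The action of a simple reflection on pairs of an element and a sign, which records how often
the element is met as a reflection. -/
noncomputable def signedConj (i : B) : Function.End (W × ZMod 2) := fun p =>
  (cs.simple i * p.1 * cs.simple i, p.2 + if p.1 = cs.simple i then 1 else 0)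

open Classical in
theorem prod_map_signedConj (ω : List B) (t : W) (e : ZMod 2) :
    (ω.map cs.signedConj).prod (t, e) =
      (cs.wordProd ω * t * (cs.wordProd ω)⁻¹, e + ((cs.rightInvSeq ω).count t : ℕ)) := by
  induction ω with
  | nil => simp; rfl
  | cons i ω ih =>
    rw [List.map_cons, List.prod_cons]
    change cs.signedConj i ((ω.map cs.signedConj).prod (t, e)) = _
    rw [ih, signedConj, rightInvSeq, List.count_cons, wordProd_cons]
    have h : cs.wordProd ω * t * (cs.wordProd ω)⁻¹ = cs.simple i ↔
        (cs.wordProd ω)⁻¹ * cs.simple i * cs.wordProd ω = t := by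
      constructor
      · intro h
        rw [← h]
        group
      · rintro rfl
        group
    simp only [h, beq_iff_eq]
    refine Prod.ext (by simp [mul_assoc]) ?_
    split_ifs <;> simp [add_assoc]

theorem isLiftable_signedConj : M.IsLiftable cs.signedConj := by
  classical
  intro i j
  have h : ∀ m : ℕ, (cs.signedConj i * cs.signedConj j) ^ m =
      ((alternatingWord i j (2 * m)).map cs.signedConj).prod := by
    intro m
    induction m with
    | zero => rfl
    | succ m ih => rw [alternatingWord_two_mul_succ, pow_succ', ih]; simp [mul_assoc]
  rw [h]
  funext ⟨t, e⟩
  rw [prod_map_signedConj, ← reverse_alternatingWord_two_mul, rightInvSeq_reverse,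
    List.count_reverse, wordProd_reverse, prod_alternatingWord_eq_mul_pow]
  have h2 := cs.even_count_leftInvSeq_alternatingWord j i t
  rw [M.symmetric] at h2
  rw [(ZMod.natCast_eq_zero_iff_even).2 h2]
  have h3 := cs.simple_mul_simple_pow j i
  rw [M.symmetric] at h3
  simp [h3]
  rfl

-- The signed conjugations satisfy the Coxeter relations, hence define an action of W; the sign
-- component of this action is the parity in question.
open Classical in
theorem count_rightInvSeq_eq_of_wordProd_eq {ω ω' : List B} (h : cs.wordProd ω = cs.wordProd ω')
    (t : W) : (((cs.rightInvSeq ω).count t : ℕ) : ZMod 2) = ((cs.rightInvSeq ω').count t : ℕ) := by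
  have key : ∀ ω : List B, cs.lift ⟨_, cs.isLiftable_signedConj⟩ (cs.wordProd ω) =
      (ω.map cs.signedConj).prod := by
    intro ω
    induction ω with
    | nil => simp
    | cons i ω ih => rw [wordProd_cons, map_mul, ih]; simp
  have h1 := congrFun (key ω) (t, 0)
  rw [h, key, prod_map_signedConj, prod_map_signedConj] at h1
  simpa using (congrArg Prod.snd h1).symm

open Classical in
theorem count_leftInvSeq_eq_of_wordProd_eq {ω ω' : List B} (h : cs.wordProd ω = cs.wordProd ω')
    (t : W) : (((cs.leftInvSeq ω).count t : ℕ) : ZMod 2) = ((cs.leftInvSeq ω').count t : ℕ) := by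
  have := cs.count_rightInvSeq_eq_of_wordProd_eq (ω := ω.reverse) (ω' := ω'.reverse)
    (by simp [h]) t
  simpa [rightInvSeq_reverse] using this

theorem mem_leftInvSeq_of_nodup {ω ω' : List B} (h : cs.wordProd ω = cs.wordProd ω')
    (hω : (cs.leftInvSeq ω).Nodup) {t : W} (ht : t ∈ cs.leftInvSeq ω) :
    t ∈ cs.leftInvSeq ω' := by
  classical
  have h1 := cs.count_leftInvSeq_eq_of_wordProd_eq h t
  rw [List.count_eq_one_of_mem hω ht] at h1
  by_contra h2
  rw [List.count_eq_zero_of_not_mem h2] at h1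
  simp at h1

/-- Each inversion occurs once, an odd number of times, so it also occurs for any reduced word of
the same element; that word is therefore at least as long. -/
theorem isReduced_of_nodup_leftInvSeq {ω : List B} (hω : (cs.leftInvSeq ω).Nodup) :
    cs.IsReduced ω := by
  obtain ⟨ω', h1, h2⟩ := cs.exists_isReduced (cs.wordProd ω)
  have h3 : (cs.leftInvSeq ω).length ≤ (cs.leftInvSeq ω').length :=
    (hω.subperm fun t ht => cs.mem_leftInvSeq_of_nodup h2 hω ht).length_le
  rw [length_leftInvSeq, length_leftInvSeq] at h3
  refine le_antisymm (cs.length_wordProd_le ω) (h3.trans ?_)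
  rw [h2, h1.eq]

/-- Exchange condition: a reduced word of the element starting with `i` has `s_i` among its
inversions, so `s_i` is an inversion of `ω`, and multiplying by it erases a letter. -/
theorem exists_wordProd_eraseIdx_of_isLeftDescent {ω : List B} {i : B}
    (h : cs.IsLeftDescent (cs.wordProd ω) i) :
    ∃ j < ω.length, cs.simple i * cs.wordProd ω = cs.wordProd (ω.eraseIdx j) := by
  obtain ⟨ω', h1, h2⟩ := cs.exists_isReduced (cs.simple i * cs.wordProd ω)
  have h3 : cs.wordProd (i :: ω') = cs.wordProd ω := by
    rw [wordProd_cons, ← h2, simple_mul_simple_cancel_left]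
  have h4 : cs.IsReduced (i :: ω') := by
    rw [IsReduced, h3, List.length_cons, ← h1.eq, ← h2]
    exact ((cs.isLeftDescent_iff).1 h).symm
  have h5 : cs.simple i ∈ cs.leftInvSeq ω :=
    cs.mem_leftInvSeq_of_nodup h3 h4.nodup_leftInvSeq (by simp [leftInvSeq])
  obtain ⟨j, hj, h6⟩ := List.mem_iff_getElem.1 h5
  rw [length_leftInvSeq] at hj
  refine ⟨j, hj, ?_⟩
  rw [← getD_leftInvSeq_mul_wordProd, ← h6, List.getD_eq_getElem]

/-! ### Dihedral subgroups and their cosets. -/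

theorem isReduced_alternatingWord {i j : B} (hij : i ≠ j) {k : ℕ} (hk : M i j = 0 ∨ k ≤ M i j) :
    cs.IsReduced (alternatingWord i j k) := by
  -- The word is viewed as the initial segment of one of length `2p`, whose inversions are explicit.
  -- The first `k ≤ p` of them are distinct because the order of `s_i s_j` is exactly `m`, with 0
  -- standing for ∞.
  have : ∃ p, k ≤ p ∧ (M i j = 0 ∨ p = M i j) := by
    rcases hk with hk | hk
    exacts [⟨k, le_rfl, .inl hk⟩, ⟨_, hk, .inr rfl⟩]
  obtain ⟨p, hkp, hp⟩ := this
  have key : ∀ x y : B, x ≠ y → M x y = M i j →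
      ((cs.leftInvSeq (alternatingWord x y (2 * p))).take k).Nodup := by
    intro x y hxy hM
    rw [leftInvSeq_alternatingWord_two_mul, ← List.map_take, List.take_range,
      min_eq_left (by omega)]
    refine (List.nodup_map_iff_inj_on List.nodup_range).2 fun a ha b hb hab => ?_
    replace ha := List.mem_range.1 ha
    replace hb := List.mem_range.1 hb
    replace hab := mul_left_cancel hab
    wlog hle : a ≤ b generalizing a b
    · exact (this b a hb ha hab.symm (by omega)).symm
    obtain ⟨c, rfl⟩ := Nat.exists_eq_add_of_le hle
    rw [pow_add, left_eq_mul] at hab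
    have hd := cs.dvd_of_simple_mul_simple_pow_eq_one hxy.symm hab
    rw [M.symmetric, hM] at hd
    rcases hp with hp | hp
    · rw [hp, zero_dvd_iff] at hd
      omega
    · rcases Nat.eq_zero_or_pos c with rfl | hc
      · rfl
      · have := Nat.le_of_dvd hc hd
        omega
  have h2 : ∀ x y : B, x ≠ y → M x y = M i j → cs.IsReduced
      ((alternatingWord x y (2 * p)).take k) := fun x y hxy hM =>
    cs.isReduced_of_nodup_leftInvSeq (by rw [leftInvSeq_take]; exact key x y hxy hM)
  rcases Nat.eq_zero_or_pos k with rfl | hk0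
  · simp [IsReduced, alternatingWord]
  by_cases he : Even k
  · have := h2 i j hij rfl
    rwa [listTake_alternatingWord _ _ _ _ (by omega), if_pos he] at this
  · have := h2 j i hij.symm (M.symmetric _ _)
    rwa [listTake_alternatingWord _ _ _ _ (by omega), if_neg he] at this

/-- The word of length `k` that alternates between `i` and `j`, starting with `i`. -/
def altFrom (i j : B) : ℕ → List B
  | 0 => []
  | k + 1 => i :: altFrom j i k

@[simp]
theorem length_altFrom (i j : B) (k : ℕ) : (altFrom i j k).length = k := by
  induction k generalizing i j with
  | zero => rfl
  | succ k ih => simp [altFrom, ih]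

theorem map_altFrom {B' : Type*} (f : B' → B) (i j : B') (k : ℕ) :
    (altFrom i j k).map f = altFrom (f i) (f j) k := by
  induction k generalizing i j with
  | zero => rfl
  | succ k ih => simp [altFrom, ih]

theorem altFrom_eq_reverse (i j : B) (k : ℕ) : altFrom i j k = (alternatingWord j i k).reverse := by
  induction k generalizing i j with
  | zero => rfl
  | succ k ih => simp [altFrom, alternatingWord_succ, ih]

theorem altFrom_eq_alternatingWord (i j : B) (k : ℕ) :
    altFrom i j k = if Even k then alternatingWord i j k else alternatingWord j i k := by
  induction k generalizing i j with
  | zero => rfl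
  | succ k ih =>
    rw [altFrom, ih, alternatingWord_succ', alternatingWord_succ']
    by_cases h : Even k <;> simp [h, parity_simps]

theorem isReduced_altFrom {i j : B} (hij : i ≠ j) {k : ℕ} (hk : M i j = 0 ∨ k ≤ M i j) :
    cs.IsReduced (altFrom i j k) := by
  rw [altFrom_eq_reverse, isReduced_reverse_iff]
  exact cs.isReduced_alternatingWord hij.symm (by rwa [M.symmetric])

theorem wordProd_altFrom_comm (i j : B) :
    cs.wordProd (altFrom i j (M i j)) = cs.wordProd (altFrom j i (M i j)) := by
  have h := cs.wordProd_braidWord_eq i j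
  rw [braidWord, braidWord, M.symmetric j i] at h
  rw [altFrom_eq_alternatingWord, altFrom_eq_alternatingWord]
  split_ifs
  exacts [h, h.symm]

theorem inv_wordProd_altFrom (i j : B) :
    (cs.wordProd (altFrom i j (M i j)))⁻¹ = cs.wordProd (altFrom i j (M i j)) := by
  have h := cs.wordProd_braidWord_eq i j
  rw [braidWord, braidWord, M.symmetric j i] at h
  rw [← wordProd_reverse, altFrom_eq_reverse, List.reverse_reverse, ← altFrom_eq_reverse,
    altFrom_eq_alternatingWord]
  split_ifs
  exacts [h.symm, rfl]

theorem simple_mul_wordProd_altFrom {i j : B} {k : ℕ} (hk : M i j = 0 ∨ k ≤ M i j) :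
    ∃ k', (M i j = 0 ∨ k' ≤ M i j) ∧
      (cs.simple i * cs.wordProd (altFrom j i k) = cs.wordProd (altFrom i j k') ∨
        cs.simple i * cs.wordProd (altFrom j i k) = cs.wordProd (altFrom j i k')) := by
  by_cases h : M i j = 0 ∨ k + 1 ≤ M i j
  · exact ⟨k + 1, h, .inl (by rw [altFrom, wordProd_cons])⟩
  · have hkM : k = M i j := by omega
    subst hkM
    rcases hm : M i j with _ | m
    · omega
    -- At full length the braid relation lets the word start with `i` as well, and that letter
    -- cancels.
    · refine ⟨m, by omega, .inr ?_⟩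
      have := cs.wordProd_altFrom_comm i j
      rw [hm] at this
      rw [← this, altFrom, wordProd_cons, simple_mul_simple_cancel_left]

theorem exists_eq_wordProd_altFrom {i j : B} {g : W}
    (hg : g ∈ Subgroup.closure {cs.simple i, cs.simple j}) :
    ∃ k, (M i j = 0 ∨ k ≤ M i j) ∧
      (g = cs.wordProd (altFrom i j k) ∨ g = cs.wordProd (altFrom j i k)) := by
  have step : ∀ x ∈ ({cs.simple i, cs.simple j} : Set W), ∀ y : W,
      (∃ k, (M i j = 0 ∨ k ≤ M i j) ∧
        (y = cs.wordProd (altFrom i j k) ∨ y = cs.wordProd (altFrom j i k))) →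
      ∃ k, (M i j = 0 ∨ k ≤ M i j) ∧
        (x * y = cs.wordProd (altFrom i j k) ∨ x * y = cs.wordProd (altFrom j i k)) := by
    have cancel : ∀ a b : B, ∀ k, (M i j = 0 ∨ k ≤ M i j) → ∃ k', (M i j = 0 ∨ k' ≤ M i j) ∧
        (cs.simple a * cs.wordProd (altFrom a b k) = cs.wordProd (altFrom a b k') ∨
          cs.simple a * cs.wordProd (altFrom a b k) = cs.wordProd (altFrom b a k')) ∨ k = 0 := by
      intro a b k hk
      rcases k with _ | k
      · exact ⟨0, .inr rfl⟩
      · exact ⟨k, .inl ⟨by omega, .inr (by rw [altFrom, wordProd_cons,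
          simple_mul_simple_cancel_left])⟩⟩
    have main : ∀ a b : B, M a b = M i j → ∀ k, (M i j = 0 ∨ k ≤ M i j) → ∀ y,
        (y = cs.wordProd (altFrom a b k) ∨ y = cs.wordProd (altFrom b a k)) →
        ∃ k', (M i j = 0 ∨ k' ≤ M i j) ∧ (cs.simple a * y = cs.wordProd (altFrom a b k') ∨
          cs.simple a * y = cs.wordProd (altFrom b a k')) := by
      intro a b hab k hk y hy
      have h0 := cs.simple_mul_wordProd_altFrom (i := a) (j := b) (k := k) (by rwa [hab])
      rw [hab] at h0
      rcases hy with rfl | rfl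
      · obtain ⟨k', h | rfl⟩ := cancel a b k hk
        · exact ⟨k', h⟩
        · exact h0
      · exact h0
    rintro x (rfl | rfl) y ⟨k, hk, hy⟩
    · exact main i j rfl k hk y hy
    · obtain ⟨k', h, h'⟩ := main j i (M.symmetric _ _) k hk y hy.symm
      exact ⟨k', h, h'.symm⟩
  induction hg using Subgroup.closure_induction_left with
  | one => exact ⟨0, by omega, .inl rfl⟩
  | mul_left x hx y _ hy => exact step x hx y hy
  | inv_mul_cancel x hx y _ hy =>
    have : x⁻¹ = x := by rcases hx with rfl | rfl <;> simp
    rw [this]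
    exact step x hx y hy

theorem wordProd_altFrom_mem (i j : B) (k : ℕ) :
    cs.wordProd (altFrom i j k) ∈ Subgroup.closure {cs.simple i, cs.simple j} := by
  induction k generalizing i j with
  | zero => simp [altFrom, one_mem]
  | succ k ih =>
    rw [altFrom, wordProd_cons]
    refine mul_mem (Subgroup.subset_closure (by simp)) ?_
    rw [Set.pair_comm]
    exact ih j i

/-- If a letter failed to increase the length, exchange would erase a letter either of the
alternating word, which is reduced, or of `v`, which is shortest in its coset. -/
theorem length_wordProd_altFrom_mul {i j : B} (hij : i ≠ j) {v : W}
    (hv : ∀ g ∈ Subgroup.closure {cs.simple i, cs.simple j}, cs.length v ≤ cs.length (g * v))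
    {k : ℕ} (hk : M i j = 0 ∨ k ≤ M i j) :
    cs.length (cs.wordProd (altFrom i j k) * v) = k + cs.length v := by
  induction k generalizing i j with
  | zero => simp [altFrom]
  | succ k ih =>
    have h1 := ih hij.symm (by rwa [Set.pair_comm]) (by rw [M.symmetric]; omega)
    rw [altFrom, wordProd_cons, mul_assoc]
    rcases cs.length_simple_mul (cs.wordProd (altFrom j i k) * v) i with h | h
    · omega
    exfalso
    obtain ⟨ω, hω, rfl⟩ := cs.exists_isReduced v
    rw [← wordProd_append] at h h1
    obtain ⟨l, hl, h2⟩ := cs.exists_wordProd_eraseIdx_of_isLeftDescent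
      (cs.isLeftDescent_iff.2 h)
    rw [List.length_append, length_altFrom] at hl
    by_cases hlk : l < k
    · rw [List.eraseIdx_append_of_lt_length (by simpa using hlk), wordProd_append,
        wordProd_append, ← mul_assoc, mul_left_inj, ← wordProd_cons] at h2
      have h3 := cs.isReduced_altFrom hij hk
      rw [altFrom, IsReduced, h2] at h3
      have h4 := cs.length_wordProd_le ((altFrom j i k).eraseIdx l)
      have h5 := List.length_eraseIdx_add_one (l := altFrom j i k) (i := l) (by simpa using hlk)
      simp only [List.length_cons, length_altFrom] at h3 h5
      omega
    · rw [List.eraseIdx_append_of_length_le (by simpa using hlk), length_altFrom,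
        wordProd_append, wordProd_append, ← mul_assoc, ← wordProd_cons] at h2
      have h3 : cs.wordProd (ω.eraseIdx (l - k)) =
          (cs.wordProd (altFrom j i k))⁻¹ * cs.wordProd (altFrom i j (k + 1)) *
            cs.wordProd ω := by
        rw [mul_assoc, altFrom, h2, inv_mul_cancel_left]
      have h4 := hv _ (mul_mem (inv_mem (by
        have := cs.wordProd_altFrom_mem j i k
        rwa [Set.pair_comm] at this)) (cs.wordProd_altFrom_mem i j (k + 1)))
      rw [← h3] at h4
      have h5 := cs.length_wordProd_le (ω.eraseIdx (l - k))
      have h6 := List.length_eraseIdx_add_one (l := ω) (i := l - k) (by omega)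
      rw [hω.eq] at h4
      omega

theorem exists_dihedral_decomposition {i j : B} (hij : i ≠ j) (y : W) :
    ∃ k v, (M i j = 0 ∨ k ≤ M i j) ∧
      (y = cs.wordProd (altFrom i j k) * v ∨ y = cs.wordProd (altFrom j i k) * v) ∧
      ∀ l, (M i j = 0 ∨ l ≤ M i j) →
        cs.length (cs.wordProd (altFrom i j l) * v) = l + cs.length v ∧
        cs.length (cs.wordProd (altFrom j i l) * v) = l + cs.length v := by
  let H := Subgroup.closure {cs.simple i, cs.simple j}
  let g := Function.argmin fun g : H => cs.length (g * y)
  have hg : ∀ g' : H, cs.length (g * y) ≤ cs.length (g' * y) :=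
    fun g' => Function.argmin_le (fun g : H => cs.length (g * y)) g'
  have hv : ∀ g' ∈ H, cs.length (g * y) ≤ cs.length (g' * (g * y)) := fun g' hg' => by
    simpa [mul_assoc] using hg ⟨g' * g, mul_mem hg' g.2⟩
  obtain ⟨k, hk, h⟩ := cs.exists_eq_wordProd_altFrom (inv_mem g.2)
  refine ⟨k, g * y, hk, ?_, fun l hl => ⟨cs.length_wordProd_altFrom_mul hij hv hl, ?_⟩⟩
  · rcases h with h | h
    · exact .inl (by rw [← h, inv_mul_cancel_left])
    · exact .inr (by rw [← h, inv_mul_cancel_left])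
  · refine cs.length_wordProd_altFrom_mul hij.symm (fun g' hg' => hv g' ?_) (by
      rwa [M.symmetric])
    rwa [Set.pair_comm] at hg'

/-- An element with two distinct left descents starts with the corresponding braid word. -/
theorem exists_eq_braid_mul {i j : B} (hij : i ≠ j) {y : W} (hi : cs.IsLeftDescent y i)
    (hj : cs.IsLeftDescent y j) :
    M i j ≠ 0 ∧ ∃ z, y = cs.wordProd (altFrom i j (M i j)) * z ∧
      cs.length y = M i j + cs.length z := by
  obtain ⟨k, v, hk, hy, hl⟩ := cs.exists_dihedral_decomposition hij y
  have hlen : cs.length y = k + cs.length v := by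
    rcases hy with rfl | rfl
    exacts [(hl k hk).1, (hl k hk).2]
  -- Were the dihedral factor not the longest one, prepending the letter it does not start with
  -- would increase the length, against the descent.
  have hkM : ¬ (M i j = 0 ∨ k + 1 ≤ M i j) := by
    intro h
    rw [isLeftDescent_iff] at hi hj
    rcases hy with rfl | rfl
    · have := (hl _ h).2
      rw [altFrom, wordProd_cons, mul_assoc] at this
      omega
    · have := (hl _ h).1
      rw [altFrom, wordProd_cons, mul_assoc] at this
      omega
  have hkM' : k = M i j := by omega
  subst hkM'
  refine ⟨by omega, v, ?_, hlen⟩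
  rcases hy with rfl | rfl
  · rfl
  · rw [wordProd_altFrom_comm]

/-- An element without the left descents `i` and `j` is shortest in its coset of the
dihedral subgroup generated by `i` and `j`. -/
theorem length_braid_mul {i j : B} (hij : i ≠ j) {y : W} (hi : ¬ cs.IsLeftDescent y i)
    (hj : ¬ cs.IsLeftDescent y j) :
    cs.length (cs.wordProd (altFrom i j (M i j)) * y) = M i j + cs.length y := by
  obtain ⟨k, v, hk, hy, hl⟩ := cs.exists_dihedral_decomposition hij y
  rcases k with _ | k
  · simp only [altFrom, wordProd_nil, one_mul, or_self] at hy
    subst hy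
    exact (hl _ (.inr le_rfl)).1
  · exfalso
    rw [not_isLeftDescent_iff] at hi hj
    rcases hy with rfl | rfl
    · rw [(hl _ hk).1, altFrom, wordProd_cons, mul_assoc, simple_mul_simple_cancel_left,
        (hl k (by omega)).2] at hi
      omega
    · rw [(hl _ hk).2, altFrom, wordProd_cons, mul_assoc, simple_mul_simple_cancel_left,
        (hl k (by omega)).1] at hj
      omega

theorem length_mul_braid {i j : B} (hij : i ≠ j) {y : W} (hi : ¬ cs.IsRightDescent y i)
    (hj : ¬ cs.IsRightDescent y j) :
    cs.length (y * cs.wordProd (altFrom i j (M i j))) = cs.length y + M i j := by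
  rw [← length_inv, mul_inv_rev, inv_wordProd_altFrom, length_braid_mul _ hij, length_inv,
    add_comm] <;> rwa [isLeftDescent_inv_iff]

/-! ### The longest element. -/

theorem length_inv_mul_of_forall_isLeftDescent {x : W} (hx : ∀ i, cs.IsLeftDescent x i) (w : W) :
    cs.length x = cs.length w + cs.length (w⁻¹ * x) := by
  obtain ⟨ω, hω, rfl⟩ := cs.exists_isReduced w
  rw [hω.eq]
  induction ω with
  | nil => simp
  | cons i ω ih =>
    have hω' : cs.IsReduced ω := by simpa using hω.drop 1
    have h1 := ih hω'
    obtain ⟨τ, hτ, h2⟩ := cs.exists_isReduced ((cs.wordProd ω)⁻¹ * x)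
    have h3 : x = cs.wordProd (ω ++ τ) := by rw [wordProd_append, ← h2, mul_inv_cancel_left]
    have h4 := hx i
    rw [h3] at h4
    obtain ⟨l, hl, h5⟩ := cs.exists_wordProd_eraseIdx_of_isLeftDescent h4
    rw [List.length_append] at hl
    rw [h2, hτ.eq] at h1
    -- With `x = ω τ`, exchange for the descent `i` cannot erase a letter of `ω`, since `i :: ω` is
    -- reduced; so it erases one of `τ`, and `i :: ω` begins a reduced word of `x`.
    by_cases hlt : l < ω.length
    · exfalso
      rw [List.eraseIdx_append_of_lt_length hlt, wordProd_append, wordProd_append, ← mul_assoc,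
        mul_left_inj, ← wordProd_cons] at h5
      have h6 := cs.length_wordProd_le (ω.eraseIdx l)
      rw [← h5, hω.eq, List.length_cons] at h6
      have := List.length_eraseIdx_add_one hlt
      omega
    · rw [← h3, List.eraseIdx_append_of_length_le (by omega), wordProd_append] at h5
      have h6 : (cs.wordProd (i :: ω))⁻¹ * x =
          (cs.wordProd ω)⁻¹ * (cs.simple i * x) := by
        rw [wordProd_cons, mul_inv_rev, inv_simple, mul_assoc]
      rw [h5, inv_mul_cancel_left] at h6
      have h7 := cs.length_wordProd_le (τ.eraseIdx (l - ω.length))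
      have h8 := List.length_eraseIdx_add_one (l := τ) (i := l - ω.length) (by omega)
      have h9 := cs.length_mul_le (cs.wordProd (i :: ω)) ((cs.wordProd (i :: ω))⁻¹ * x)
      rw [mul_inv_cancel_left, hω.eq] at h9
      rw [h6] at h9 ⊢
      simp only [List.length_cons] at h9 ⊢
      omega

theorem exists_forall_isLeftDescent [Finite W] : ∃ x, ∀ i, cs.IsLeftDescent x i := by
  obtain ⟨x, hx⟩ := Finite.exists_max cs.length
  refine ⟨x, fun i => lt_of_le_of_ne (hx _) (cs.length_simple_mul_ne x i)⟩

/-- The element `s_i x` is a prefix of `x` and one shorter, so the remaining factor `x⁻¹ s_i x` has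
length 1. -/
theorem exists_simple_conj {x : W} (hx : ∀ i, cs.IsLeftDescent x i) (i : B) :
    ∃ j, cs.simple i * x = x * cs.simple j := by
  have h1 := cs.length_inv_mul_of_forall_isLeftDescent hx (cs.simple i * x)
  have h2 := (cs.isLeftDescent_iff).1 (hx i)
  rw [mul_inv_rev, inv_simple] at h1
  obtain ⟨j, hj⟩ := cs.length_eq_one_iff.1
    (show cs.length (x⁻¹ * cs.simple i * x) = 1 by omega)
  exact ⟨j, by rw [← hj, mul_assoc, mul_inv_cancel_left]⟩

/-! ### Reduced words in the letters of a subgraph. -/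

variable {B' : Type*} (f : B' ↪ B)

theorem exists_isReduced_map_of_isLeftDescent {ω : List B'} (hω : cs.IsReduced (ω.map f)) {i : B'}
    (hi : cs.IsLeftDescent (cs.wordProd (ω.map f)) (f i)) :
    ∃ τ : List B', cs.IsReduced (τ.map f) ∧
      cs.simple (f i) * cs.wordProd (ω.map f) = cs.wordProd (τ.map f) := by
  obtain ⟨l, hl, h⟩ := cs.exists_wordProd_eraseIdx_of_isLeftDescent hi
  refine ⟨ω.eraseIdx l, ?_, ?_⟩
  · rw [isLeftDescent_iff, hω.eq, h, List.length_map] at hi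
    rw [List.length_map] at hl
    have := List.length_eraseIdx_add_one hl
    rw [IsReduced, List.length_map, ← List.eraseIdx_map]
    omega
  · rw [h, List.eraseIdx_map]

/-- Exchange only erases letters, so stripping the alternating prefix letter by letter never leaves
the alphabet of the subgraph. -/
theorem exists_isReduced_map_of_eq_altFrom_mul {ω : List B'} (hω : cs.IsReduced (ω.map f))
    (i j : B') (k : ℕ) {z : W}
    (hz : cs.wordProd (ω.map f) = cs.wordProd ((altFrom i j k).map f) * z)
    (hl : cs.length (cs.wordProd (ω.map f)) = k + cs.length z) :
    ∃ τ : List B', cs.IsReduced (τ.map f) ∧ z = cs.wordProd (τ.map f) := by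
  induction k generalizing ω i j with
  | zero => exact ⟨ω, hω, by simpa [altFrom] using hz.symm⟩
  | succ k ih =>
    have h1 : cs.simple (f i) * cs.wordProd (ω.map f) =
        cs.wordProd ((altFrom j i k).map f) * z := by
      rw [hz, altFrom, List.map_cons, wordProd_cons, mul_assoc, simple_mul_simple_cancel_left]
    have h2 := cs.length_mul_le (cs.wordProd ((altFrom j i k).map f)) z
    have h3 := cs.length_wordProd_le ((altFrom j i k).map f)
    rw [← h1] at h2
    rw [List.length_map, length_altFrom] at h3
    have h4 : cs.IsLeftDescent (cs.wordProd (ω.map f)) (f i) := by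
      rw [IsLeftDescent]
      omega
    obtain ⟨τ, hτ, h5⟩ := cs.exists_isReduced_map_of_isLeftDescent f hω h4
    refine ih hτ j i (by rw [← h5, h1]) ?_
    rw [isLeftDescent_iff, h5] at h4
    omega

end CoxeterSystem

/-! ### The Artin monoid and Matsumoto's theorem. -/

namespace ArtinMonoid

open CoxeterSystem

variable {B : Type*}

/-- The element of the Artin monoid represented by a word. -/
def ofWord (M : CoxeterMatrix B) (ω : List B) : ArtinMonoid M :=
  PresentedMonoid.mk M.artinRel (FreeMonoid.ofList ω)

variable (M : CoxeterMatrix B)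

theorem ofWord_nil : ofWord M [] = 1 := rfl

theorem ofWord_append (ω τ : List B) : ofWord M (ω ++ τ) = ofWord M ω * ofWord M τ := by
  rw [ofWord, FreeMonoid.ofList_append, map_mul]
  rfl

theorem ofWord_cons (i : B) (ω : List B) : ofWord M (i :: ω) = gen M i * ofWord M ω :=
  ofWord_append M [i] ω

theorem ofWord_surjective : Function.Surjective (ofWord M) := fun a => by
  obtain ⟨b, rfl⟩ := PresentedMonoid.surjective_mk a
  exact ⟨b.toList, rfl⟩

theorem ofWord_altFrom_comm {i j : B} (h : M i j ≠ 0) :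
    ofWord M (altFrom i j (M i j)) = ofWord M (altFrom j i (M i j)) := by
  have : ofWord M (alternatingWord i j (M i j)) = ofWord M (alternatingWord j i (M i j)) :=
    PresentedMonoid.mk_eq_mk_of_rel ⟨i, j, h, rfl, rfl⟩
  rw [altFrom_eq_alternatingWord, altFrom_eq_alternatingWord]
  split_ifs
  exacts [this, this.symm]

variable {M} {W : Type*} [Group W] (cs : CoxeterSystem M W)

/-- The projection of the Artin monoid onto the Coxeter group. -/
def toGroup : ArtinMonoid M →* W :=
  PresentedMonoid.lift cs.simple (by
    rintro _ _ ⟨s, t, _, rfl, rfl⟩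
    have := cs.wordProd_braidWord_eq s t
    rw [braidWord, braidWord, M.symmetric t s] at this
    rwa [FreeMonoid.lift_ofList, FreeMonoid.lift_ofList])

@[simp]
theorem toGroup_gen (i : B) : toGroup cs (gen M i) = cs.simple i := rfl

@[simp]
theorem toGroup_ofWord (ω : List B) : toGroup cs (ofWord M ω) = cs.wordProd ω := by
  induction ω with
  | nil => simp [ofWord_nil]
  | cons i ω ih => rw [ofWord_cons, map_mul, ih, toGroup_gen, wordProd_cons]

/-- Two reduced words for the same element, in the letters of a full subgraph, represent the
same element of the Artin monoid of the subgraph (Matsumoto). -/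
theorem ofWord_eq_ofWord_of_isReduced_map {B' : Type*} (f : B' ↪ B) {ω τ : List B'}
    (hω : cs.IsReduced (ω.map f)) (hτ : cs.IsReduced (τ.map f))
    (h : cs.wordProd (ω.map f) = cs.wordProd (τ.map f)) :
    ofWord (M.restrict f) ω = ofWord (M.restrict f) τ := by
  induction hn : ω.length using Nat.strong_induction_on generalizing ω τ with
  | _ n ih =>
  have hlen : ω.length = τ.length := by
    have := hω.eq
    rw [h, hτ.eq] at this
    simpa using this.symm
  rcases ω with _ | ⟨i, ω⟩
  · rw [List.length_nil, eq_comm, List.length_eq_zero_iff] at hlen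
    rw [hlen]
  rcases τ with _ | ⟨j, τ⟩
  · simp at hlen
  have tail : ∀ {a : B'} {σ : List B'}, cs.IsReduced ((a :: σ).map f) →
      cs.IsReduced (σ.map f) := fun h => by simpa using h.drop 1
  have cons_eq : ∀ {a : B'} {σ σ' : List B'}, σ.length < n → cs.IsReduced ((a :: σ).map f) →
      cs.IsReduced ((a :: σ').map f) →
      cs.wordProd ((a :: σ).map f) = cs.wordProd ((a :: σ').map f) →
      ofWord (M.restrict f) (a :: σ) = ofWord (M.restrict f) (a :: σ') := by
    intro a σ σ' hσ h1 h2 h3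
    rw [List.map_cons, List.map_cons, wordProd_cons, wordProd_cons, mul_right_inj] at h3
    rw [ofWord_cons, ofWord_cons, ih _ hσ (tail h1) (tail h2) h3 rfl]
  simp only [List.length_cons] at hn hlen
  by_cases hij : i = j
  · subst hij
    exact cons_eq (by omega) hω hτ h
  have desc : ∀ {a : B'} {σ : List B'}, cs.IsReduced ((a :: σ).map f) →
      cs.IsLeftDescent (cs.wordProd ((a :: σ).map f)) (f a) := by
    intro a σ h1
    rw [isLeftDescent_iff, h1.eq, List.map_cons, wordProd_cons, simple_mul_simple_cancel_left,
      (tail h1).eq, List.length_cons]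
  have hi := desc hω
  have hj := desc hτ
  rw [← h] at hj
  obtain ⟨hm, z, hz, hzl⟩ := cs.exists_eq_braid_mul (fun e => hij (f.injective e)) hi hj
  rw [← map_altFrom] at hz
  -- The remainder after the braid is spelled in the subgraph. The braid word starting with `i`,
  -- followed by `ρ`, shares its first letter with one given word, and the version starting with `j`
  -- with the other; induction applies to the tails.
  obtain ⟨ρ, hρ, rfl⟩ := cs.exists_isReduced_map_of_eq_altFrom_mul f hω i j _ hz hzl
  have hM : (M.restrict f) i j = M (f i) (f j) := rfl
  have hz' : cs.wordProd ((i :: ω).map f) = cs.wordProd ((altFrom j i (M (f i) (f j))).map f) *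
      cs.wordProd (ρ.map f) := by
    rw [hz, map_altFrom, map_altFrom, wordProd_altFrom_comm]
  rw [hω.eq, hρ.eq, List.length_map, List.length_map, List.length_cons] at hzl
  obtain ⟨m, hm'⟩ := Nat.exists_eq_succ_of_ne_zero hm
  have hcomm := ofWord_altFrom_comm (M.restrict f) (i := i) (j := j) hm
  rw [hM] at hcomm
  rw [hm'] at hz hz' hcomm hzl
  rw [← wordProd_append, ← List.map_append] at hz hz'
  have red : ∀ a b : B', cs.wordProd ((i :: ω).map f) =
      cs.wordProd ((altFrom a b (m + 1) ++ ρ).map f) →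
      cs.IsReduced ((altFrom a b (m + 1) ++ ρ).map f) := by
    intro a b e
    rw [CoxeterSystem.IsReduced, ← e, hω.eq]
    simp
    omega
  calc ofWord (M.restrict f) (i :: ω)
      _ = ofWord (M.restrict f) (altFrom i j (m + 1) ++ ρ) :=
        cons_eq (by omega) hω (red i j hz) hz
      _ = ofWord (M.restrict f) (altFrom j i (m + 1) ++ ρ) := by
        rw [ofWord_append, ofWord_append, hcomm]
      _ = ofWord (M.restrict f) (j :: τ) :=
        (cons_eq (by omega) hτ (red j i hz') (h.symm.trans hz')).symm

theorem ofWord_eq_ofWord_of_isReduced {ω τ : List B} (hω : cs.IsReduced ω) (hτ : cs.IsReduced τ)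
    (h : cs.wordProd ω = cs.wordProd τ) : ofWord M ω = ofWord M τ := by
  have e : ∀ σ : List B, σ.map (Function.Embedding.refl B) = σ := List.map_id
  exact ofWord_eq_ofWord_of_isReduced_map cs (Function.Embedding.refl B) (by rwa [e])
    (by rwa [e]) (by rwa [e, e])

/-- A word that is reduced in the Coxeter group of a full subgraph is reduced in the whole
group. -/
theorem isReduced_map {B' W' : Type*} [Group W'] (f : B' ↪ B)
    (cs' : CoxeterSystem (M.restrict f) W') {ω : List B'} (hω : cs'.IsReduced ω) :
    cs.IsReduced (ω.map f) := by
  induction ω with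
  | nil => simp [CoxeterSystem.IsReduced]
  | cons i ω ih =>
    have hω' : cs'.IsReduced ω := by simpa using hω.drop 1
    have h1 := ih hω'
    rw [List.map_cons, CoxeterSystem.IsReduced, wordProd_cons, List.length_cons, ← h1.eq]
    rcases cs.length_simple_mul (cs.wordProd (ω.map f)) (f i) with h | h
    · exact h
    exfalso
    obtain ⟨τ, hτ, h2⟩ := cs.exists_isReduced_map_of_isLeftDescent f h1 (cs.isLeftDescent_iff.2 h)
    have h3 : cs.wordProd ((i :: τ).map f) = cs.wordProd (ω.map f) := by
      rw [List.map_cons, wordProd_cons, ← h2, simple_mul_simple_cancel_left]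
    have h4 : ω.length = τ.length + 1 := by
      rw [h2, hτ.eq, h1.eq] at h
      simpa using h.symm
    -- Matsumoto's theorem turns an equality in W into one in the Artin monoid of the subgraph,
    -- hence in its own Coxeter group, where it shortens `i :: ω`.
    have h5 := ofWord_eq_ofWord_of_isReduced_map cs f (ω := i :: τ) (by
      rw [CoxeterSystem.IsReduced, h3, h1.eq]
      simpa using h4) h1 h3
    have h6 := congrArg (toGroup cs') h5
    rw [toGroup_ofWord, toGroup_ofWord, wordProd_cons] at h6
    have h7 := hω.eq
    rw [wordProd_cons, ← h6, simple_mul_simple_cancel_left] at h7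
    have := cs'.length_wordProd_le τ
    simp only [List.length_cons] at h7
    omega

end ArtinMonoid

/-! ### The weak order. -/

namespace CoxeterSystem

variable {B W : Type*} [Group W] {M : CoxeterMatrix B} (cs : CoxeterSystem M W)

/-- The left prefix relation (right weak order). -/
def IsPrefix (w x : W) : Prop := cs.length x = cs.length w + cs.length (w⁻¹ * x)

variable {cs}

theorem isPrefix_of_le {w x : W} (h : cs.length w + cs.length (w⁻¹ * x) ≤ cs.length x) :
    cs.IsPrefix w x := by
  refine le_antisymm ?_ h
  simpa using cs.length_mul_le w (w⁻¹ * x)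

theorem isPrefix_one (x : W) : cs.IsPrefix 1 x := by simp [IsPrefix]

theorem isPrefix_refl (x : W) : cs.IsPrefix x x := by simp [IsPrefix]

theorem IsPrefix.trans {a b c : W} (h : cs.IsPrefix a b) (h' : cs.IsPrefix b c) :
    cs.IsPrefix a c := by
  apply isPrefix_of_le
  rw [IsPrefix] at h h'
  have := cs.length_mul_le (a⁻¹ * b) (b⁻¹ * c)
  rw [mul_assoc, mul_inv_cancel_left] at this
  omega

theorem IsPrefix.exists_step {w x : W} (h : cs.IsPrefix w x) (hne : x ≠ w) :
    ∃ i, ¬ cs.IsRightDescent w i ∧ cs.IsPrefix (w * cs.simple i) x := by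
  have h1 : w⁻¹ * x ≠ 1 := fun e => hne (inv_mul_eq_one.1 e).symm
  obtain ⟨i, hi⟩ := cs.exists_leftDescent_of_ne_one h1
  rw [isLeftDescent_iff] at hi
  have h2 : (w * cs.simple i)⁻¹ * x = cs.simple i * (w⁻¹ * x) := by simp [mul_assoc]
  have h3 := cs.length_mul_le (w * cs.simple i) ((w * cs.simple i)⁻¹ * x)
  rw [mul_inv_cancel_left, h2] at h3
  rw [IsPrefix] at h
  have h4 := cs.length_mul_simple w i
  refine ⟨i, ?_, isPrefix_of_le ?_⟩
  · rw [not_isRightDescent_iff]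
    omega
  · rw [h2]
    omega

theorem isPrefix_mul_braid {w : W} {i j : B} (hij : i ≠ j) (hm : M i j ≠ 0)
    (hi : ¬ cs.IsRightDescent w i) (hj : ¬ cs.IsRightDescent w j) :
    cs.IsPrefix (w * cs.simple i) (w * cs.wordProd (altFrom i j (M i j))) := by
  apply isPrefix_of_le
  rw [cs.length_mul_braid hij hi hj]
  obtain ⟨m, hm⟩ := Nat.exists_eq_succ_of_ne_zero hm
  have h := cs.length_wordProd_le (altFrom j i m)
  rw [length_altFrom] at h
  rw [not_isRightDescent_iff] at hi
  have : (w * cs.simple i)⁻¹ * (w * cs.wordProd (altFrom i j (M i j))) =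
      cs.wordProd (altFrom j i m) := by
    rw [hm, altFrom, wordProd_cons]
    simp [mul_assoc]
  rw [this]
  omega

end CoxeterSystem

/-! ### Length and simple elements of the Artin monoid. -/

namespace ArtinMonoid

open CoxeterSystem

variable {B : Type*} {M : CoxeterMatrix B}

/-- The word length, as a homomorphism. -/
def lengthHom (M : CoxeterMatrix B) : ArtinMonoid M →* Multiplicative ℕ :=
  PresentedMonoid.lift (fun _ => Multiplicative.ofAdd 1) (by
    rintro _ _ ⟨s, t, _, rfl, rfl⟩
    simp [FreeMonoid.lift_ofList])

/-- The word length of an element of the Artin monoid. -/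
def length (a : ArtinMonoid M) : ℕ := (lengthHom M a).toAdd

@[simp]
theorem length_mul (a b : ArtinMonoid M) : length (a * b) = length a + length b := by
  simp [length]

@[simp]
theorem length_one : length (1 : ArtinMonoid M) = 0 := by
  simp [length]

@[simp]
theorem length_gen (i : B) : length (gen M i) = 1 := rfl

@[simp]
theorem length_ofWord (ω : List B) : length (ofWord M ω) = ω.length := by
  induction ω with
  | nil => simp [ofWord_nil]
  | cons i ω ih => rw [ofWord_cons, length_mul, ih, length_gen, List.length_cons, add_comm]

theorem exists_eq_gen_mul {a : ArtinMonoid M} (ha : a ≠ 1) : ∃ i b, a = gen M i * b := by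
  obtain ⟨ω, rfl⟩ := ofWord_surjective M a
  rcases ω with _ | ⟨i, ω⟩
  · exact absurd rfl ha
  · exact ⟨i, _, ofWord_cons M i ω⟩

theorem exists_eq_mul_gen {a : ArtinMonoid M} (ha : a ≠ 1) : ∃ i b, a = b * gen M i := by
  obtain ⟨ω, rfl⟩ := ofWord_surjective M a
  induction ω using List.reverseRecOn with
  | nil => exact absurd rfl ha
  | append_singleton ω i _ => exact ⟨i, _, ofWord_append M ω [i]⟩

theorem eq_one_of_length_eq_zero {a : ArtinMonoid M} (ha : length a = 0) : a = 1 := by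
  by_contra h
  obtain ⟨i, b, rfl⟩ := exists_eq_gen_mul h
  simp at ha

variable {W : Type*} [Group W] (cs : CoxeterSystem M W)

/-- The canonical section of the projection to the Coxeter group, by reduced words. -/
noncomputable def simpleLift (w : W) : ArtinMonoid M :=
  ofWord M (cs.exists_isReduced w).choose

theorem simpleLift_wordProd {ω : List B} (hω : cs.IsReduced ω) :
    simpleLift cs (cs.wordProd ω) = ofWord M ω :=
  have h := (cs.exists_isReduced (cs.wordProd ω)).choose_spec
  ofWord_eq_ofWord_of_isReduced cs h.1 hω h.2.symm

@[simp]
theorem length_simpleLift (w : W) : length (simpleLift cs w) = cs.length w := by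
  obtain ⟨ω, hω, rfl⟩ := cs.exists_isReduced w
  rw [simpleLift_wordProd cs hω, length_ofWord, hω.eq]

@[simp]
theorem toGroup_simpleLift (w : W) : toGroup cs (simpleLift cs w) = w := by
  obtain ⟨ω, hω, rfl⟩ := cs.exists_isReduced w
  rw [simpleLift_wordProd cs hω, toGroup_ofWord]

theorem simpleLift_mul {w x : W} (h : cs.length (w * x) = cs.length w + cs.length x) :
    simpleLift cs (w * x) = simpleLift cs w * simpleLift cs x := by
  obtain ⟨ω, hω, rfl⟩ := cs.exists_isReduced w
  obtain ⟨τ, hτ, rfl⟩ := cs.exists_isReduced x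
  have : cs.IsReduced (ω ++ τ) := by
    rw [CoxeterSystem.IsReduced, wordProd_append, h, hω.eq, hτ.eq, List.length_append]
  rw [← wordProd_append, simpleLift_wordProd cs this, simpleLift_wordProd cs hω,
    simpleLift_wordProd cs hτ, ofWord_append]

theorem simpleLift_one : simpleLift cs 1 = 1 :=
  eq_one_of_length_eq_zero (by simp)

theorem simpleLift_simple (i : B) : simpleLift cs (cs.simple i) = gen M i := by
  have h : cs.IsReduced [i] := by simp [CoxeterSystem.IsReduced]
  have := simpleLift_wordProd cs h
  rwa [wordProd_singleton] at this

theorem simpleLift_eq_of_isPrefix {w x : W} (h : cs.IsPrefix w x) :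
    simpleLift cs x = simpleLift cs w * simpleLift cs (w⁻¹ * x) := by
  rw [← simpleLift_mul, mul_inv_cancel_left]
  rw [mul_inv_cancel_left]
  exact h

theorem simpleLift_eq_gen_mul {y : W} {i : B} (h : cs.IsLeftDescent y i) :
    simpleLift cs y = gen M i * simpleLift cs (cs.simple i * y) := by
  rw [← simpleLift_simple cs, ← simpleLift_mul, simple_mul_simple_cancel_left]
  rw [simple_mul_simple_cancel_left, length_simple, add_comm]
  exact (cs.isLeftDescent_iff.1 h).symm

theorem simpleLift_mul_simple {y : W} {i : B} (h : ¬ cs.IsRightDescent y i) :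
    simpleLift cs (y * cs.simple i) = simpleLift cs y * gen M i := by
  rw [← simpleLift_simple cs, simpleLift_mul]
  rw [length_simple]
  exact cs.not_isRightDescent_iff.1 h

/-! ### Simple common multiples and left cancellation. -/

/-- The equality `gen i * a = gen j * b` holds because of a common simple left divisor `y` of
both sides that is divisible by both generators. -/
def HasSimpleLcm (i : B) (a : ArtinMonoid M) (j : B) (b : ArtinMonoid M) : Prop :=
  ∃ y f, cs.IsLeftDescent y i ∧ cs.IsLeftDescent y j ∧
    a = simpleLift cs (cs.simple i * y) * f ∧ b = simpleLift cs (cs.simple j * y) * f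

/-- Equalities `gen i * a = gen j * b` between elements of length at most `n` are explained by
simple common multiples. -/
def SimpleLcmsUpTo (n : ℕ) : Prop :=
  ∀ (i j : B) (a b : ArtinMonoid M), length a < n → gen M i * a = gen M j * b →
    HasSimpleLcm cs i a j b

variable {cs}

theorem HasSimpleLcm.symm {i j : B} {a b : ArtinMonoid M} (h : HasSimpleLcm cs i a j b) :
    HasSimpleLcm cs j b i a := by
  obtain ⟨y, f, h1, h2, h3, h4⟩ := h
  exact ⟨y, f, h2, h1, h4, h3⟩

theorem hasSimpleLcm_refl (i : B) (a : ArtinMonoid M) : HasSimpleLcm cs i a i a := by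
  have h : cs.IsLeftDescent (cs.simple i) i := by simp [IsLeftDescent]
  exact ⟨cs.simple i, a, h, h, by simp [simpleLift_one], by simp [simpleLift_one]⟩

theorem SimpleLcmsUpTo.cancel_gen {n : ℕ} (H : SimpleLcmsUpTo cs n) {i : B} {a b : ArtinMonoid M}
    (hn : length a < n) (h : gen M i * a = gen M i * b) : a = b := by
  obtain ⟨y, f, -, -, rfl, rfl⟩ := H i i a b hn h
  rfl

theorem SimpleLcmsUpTo.cancel {n : ℕ} (H : SimpleLcmsUpTo cs n) (c : ArtinMonoid M)
    {a b : ArtinMonoid M} (hn : length (c * a) ≤ n) (h : c * a = c * b) : a = b := by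
  obtain ⟨ω, rfl⟩ := ofWord_surjective M c
  induction ω with
  | nil => simpa [ofWord_nil] using h
  | cons i ω ih =>
    simp only [ofWord_cons, length_mul, length_gen, mul_assoc] at h hn
    have hn' : length (ofWord M ω * a) < n := by
      rw [length_mul]
      omega
    exact ih hn'.le (H.cancel_gen hn' h)

/-- The simple left divisors `w` of `d` whose product with `v` is length-additive. -/
def IsSimpleDivisor (cs : CoxeterSystem M W) (v : W) (d : ArtinMonoid M) (w : W) : Prop :=
  cs.length (v * w) = cs.length v + cs.length w ∧ LeftDvd (simpleLift cs w) d

theorem IsSimpleDivisor.of_isPrefix {v : W} {d : ArtinMonoid M} {w x : W}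
    (hx : IsSimpleDivisor cs v d x) (h : cs.IsPrefix w x) : IsSimpleDivisor cs v d w := by
  obtain ⟨h1, e, h2⟩ := hx
  refine ⟨?_, simpleLift cs (w⁻¹ * x) * e, ?_⟩
  · have h3 := cs.length_mul_le (v * w) (w⁻¹ * x)
    rw [mul_assoc, mul_inv_cancel_left] at h3
    have h4 := cs.length_mul_le v w
    rw [IsPrefix] at h
    omega
  · rw [h2, simpleLift_eq_of_isPrefix cs h, mul_assoc]

theorem IsSimpleDivisor.length_le {v : W} {d : ArtinMonoid M} {w : W}
    (hw : IsSimpleDivisor cs v d w) : cs.length w ≤ length d := by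
  obtain ⟨-, e, rfl⟩ := hw
  simp

/-- Local confluence: cancelling `w` leaves an equality of the kind covered by `H`. Its common
simple divisor has both descents, so it starts with the braid of `i` and `j`. -/
theorem SimpleLcmsUpTo.isSimpleDivisor_mul_braid {n : ℕ} (H : SimpleLcmsUpTo cs n) {v w : W}
    {d : ArtinMonoid M} (hd : length d ≤ n) {i j : B} (hij : i ≠ j)
    (hw : IsSimpleDivisor cs v d w)
    (hi : ¬ cs.IsRightDescent w i) (hj : ¬ cs.IsRightDescent w j)
    (hwi : IsSimpleDivisor cs v d (w * cs.simple i))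
    (hwj : IsSimpleDivisor cs v d (w * cs.simple j)) :
    M i j ≠ 0 ∧ IsSimpleDivisor cs v d (w * cs.wordProd (altFrom i j (M i j))) := by
  obtain ⟨h1, e, he⟩ := hwi
  obtain ⟨h2, e', he'⟩ := hwj
  have h0 := hw.1
  rw [simpleLift_mul_simple cs hi, mul_assoc] at he
  rw [simpleLift_mul_simple cs hj, mul_assoc] at he'
  have heq : gen M i * e = gen M j * e' :=
    H.cancel (simpleLift cs w) (by rwa [← he]) (by rw [← he, ← he'])
  have hlt : length e < n := by
    rw [he, length_mul, length_mul, length_gen] at hd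
    omega
  obtain ⟨y, f, hyi, hyj, rfl, rfl⟩ := H i j e e' hlt heq
  obtain ⟨hm, z, rfl, hz⟩ := cs.exists_eq_braid_mul hij hyi hyj
  have hΔ : cs.length (cs.wordProd (altFrom i j (M i j))) = M i j := by
    simpa using (cs.isReduced_altFrom hij (.inr le_rfl)).eq
  refine ⟨hm, ?_, simpleLift cs z * f, ?_⟩
  · rw [← mul_assoc, cs.not_isRightDescent_iff.1 hi] at h1
    rw [← mul_assoc, cs.not_isRightDescent_iff.1 hj] at h2
    have hvi : ¬ cs.IsRightDescent (v * w) i := cs.not_isRightDescent_iff.2 (by omega)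
    have hvj : ¬ cs.IsRightDescent (v * w) j := cs.not_isRightDescent_iff.2 (by omega)
    rw [← mul_assoc, cs.length_mul_braid hij hvi hvj, cs.length_mul_braid hij hi hj, h0, add_assoc]
  · rw [he, ← mul_assoc (gen M i), ← simpleLift_eq_gen_mul cs hyi, simpleLift_mul,
      simpleLift_mul, mul_assoc, mul_assoc]
    · rw [cs.length_mul_braid hij hi hj, hΔ]
    · rw [hz, hΔ]

/-- A diamond argument: local confluence at `w` is propagated upwards, which terminates because
simple divisors of `d` are no longer than `d`. -/
theorem SimpleLcmsUpTo.directed {n : ℕ} (H : SimpleLcmsUpTo cs n) {v w : W}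
    {d : ArtinMonoid M} (hd : length d ≤ n) {p q : W}
    (hp : IsSimpleDivisor cs v d p) (hq : IsSimpleDivisor cs v d q)
    (hwp : cs.IsPrefix w p) (hwq : cs.IsPrefix w q) :
    ∃ x, IsSimpleDivisor cs v d x ∧ cs.IsPrefix p x ∧ cs.IsPrefix q x := by
  induction hk : length d - cs.length w using Nat.strong_induction_on generalizing w p q with
  | _ k ih =>
  have hw := hp.of_isPrefix hwp
  by_cases hpw : p = w
  · subst hpw
    exact ⟨q, hq, hwq, isPrefix_refl q⟩
  by_cases hqw : q = w
  · subst hqw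
    exact ⟨p, hp, isPrefix_refl p, hwp⟩
  obtain ⟨i, hi, hip⟩ := hwp.exists_step hpw
  obtain ⟨j, hj, hjq⟩ := hwq.exists_step hqw
  have hwi := hp.of_isPrefix hip
  have hwj := hq.of_isPrefix hjq
  have step : ∀ l, ¬ cs.IsRightDescent w l → IsSimpleDivisor cs v d (w * cs.simple l) →
      length d - cs.length (w * cs.simple l) < k := by
    intro l hl hwl
    have := hwl.length_le
    rw [cs.not_isRightDescent_iff.1 hl] at this ⊢
    omega
  by_cases hij : i = j
  · subst hij
    exact ih _ (step i hi hwi) hp hq hip hjq rfl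
  obtain ⟨hm, hz⟩ := H.isSimpleDivisor_mul_braid hd hij hw hi hj hwi hwj
  have hzi := isPrefix_mul_braid hij hm hi hj
  have hzj := isPrefix_mul_braid (Ne.symm hij) (by rwa [M.symmetric]) hj hi
  rw [M.symmetric j i, ← wordProd_altFrom_comm] at hzj
  obtain ⟨x, hx, hpx, hzx⟩ := ih _ (step i hi hwi) hp hz hip hzi rfl
  obtain ⟨x', hx', hxx', hqx'⟩ := ih _ (step j hj hwj) hx hq (hzj.trans hzx) hjq rfl
  exact ⟨x', hx', hpx.trans hxx', hqx'⟩

/-- Both witnesses, stripped of `l`, are simple divisors of `d`. A common upper bound `x` for which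
`s_l x` is still length-additive yields the witness `s_l x`. Only `d`, one letter shorter than the
equality, is examined, which drives the induction on length. -/
theorem SimpleLcmsUpTo.hasSimpleLcm_trans {n : ℕ} (H : SimpleLcmsUpTo cs n) {i j l : B}
    {a b d : ArtinMonoid M} (hd : length d ≤ n) (h : HasSimpleLcm cs i a l d)
    (h' : HasSimpleLcm cs l d j b) : HasSimpleLcm cs i a j b := by
  obtain ⟨y, f, hyi, hyl, rfl, hdf⟩ := h
  obtain ⟨y', f', hyl', hyj', hdf', rfl⟩ := h'
  have mem : ∀ y f, cs.IsLeftDescent y l → d = simpleLift cs (cs.simple l * y) * f →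
      IsSimpleDivisor cs (cs.simple l) d (cs.simple l * y) := by
    intro y f hy hf
    refine ⟨?_, f, hf⟩
    rw [simple_mul_simple_cancel_left, length_simple, add_comm]
    exact (cs.isLeftDescent_iff.1 hy).symm
  obtain ⟨x, ⟨hx, e, he⟩, hyx, hyx'⟩ := H.directed hd (mem y f hyl hdf) (mem y' f' hyl' hdf')
    (isPrefix_one _) (isPrefix_one _)
  have side : ∀ k y f, cs.IsLeftDescent y k → cs.IsLeftDescent y l →
      d = simpleLift cs (cs.simple l * y) * f → cs.IsPrefix (cs.simple l * y) x →
      cs.IsLeftDescent (cs.simple l * x) k ∧ simpleLift cs (cs.simple k * y) * f =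
        simpleLift cs (cs.simple k * (cs.simple l * x)) * e := by
    intro k y f hk hl hf hp
    have hf' : f = simpleLift cs ((cs.simple l * y)⁻¹ * x) * e := by
      apply H.cancel (simpleLift cs (cs.simple l * y)) (by rwa [← hf])
      rw [← mul_assoc, ← simpleLift_eq_of_isPrefix cs hp, ← hf, he]
    set z := (cs.simple l * y)⁻¹ * x with hz
    have hyz : cs.simple l * x = y * z := by
      rw [hz, mul_inv_rev, inv_simple, mul_assoc, mul_inv_cancel_left]
    rw [IsPrefix, ← hz] at hp
    rw [isLeftDescent_iff] at hk hl
    rw [length_simple] at hx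
    rw [hyz] at hx ⊢
    have h1 := cs.length_mul_le (cs.simple k * y) z
    rw [mul_assoc] at h1
    have h2 : cs.IsLeftDescent (y * z) k := by
      rw [IsLeftDescent]
      omega
    refine ⟨h2, ?_⟩
    rw [isLeftDescent_iff] at h2
    rw [hf', ← mul_assoc (cs.simple k), simpleLift_mul cs (w := cs.simple k * y), mul_assoc]
    rw [mul_assoc]
    omega
  obtain ⟨h1, h2⟩ := side i y f hyi hyl hdf hyx
  obtain ⟨h3, h4⟩ := side j y' f' hyj' hyl' hdf' hyx'
  exact ⟨cs.simple l * x, e, h1, h3, h2, h4⟩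

variable (cs) in
theorem hasSimpleLcm_braid {i j : B} (hij : i ≠ j) {m : ℕ} (hm : M i j = m + 1) (r : List B) :
    HasSimpleLcm cs i (ofWord M (altFrom j i m ++ r)) j (ofWord M (altFrom i j m ++ r)) := by
  have key : ∀ i j : B, i ≠ j → M i j = m + 1 →
      cs.IsLeftDescent (cs.wordProd (altFrom i j (M i j))) i ∧
      simpleLift cs (cs.simple i * cs.wordProd (altFrom i j (M i j))) =
        ofWord M (altFrom j i m) := by
    intro i j hij hm
    have h1 := cs.isReduced_altFrom hij.symm (k := m) (.inr (by rw [M.symmetric]; omega))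
    have h2 := (cs.isReduced_altFrom hij (k := M i j) (.inr le_rfl)).eq
    rw [isLeftDescent_iff, h2, hm, altFrom, wordProd_cons, simple_mul_simple_cancel_left,
      simpleLift_wordProd cs h1, h1.eq]
    simp
  obtain ⟨h1, h2⟩ := key i j hij hm
  obtain ⟨h3, h4⟩ := key j i hij.symm (by rwa [M.symmetric])
  rw [M.symmetric j i, ← wordProd_altFrom_comm] at h3 h4
  exact ⟨_, ofWord M r, h1, h3, by rw [h2, ofWord_append], by rw [h4, ofWord_append]⟩

/-- The contexts `l` and `r` reduce a product of two congruences to transitivity through an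
intermediate word. A single relation either sits behind an unchanged first letter or is itself the
simple common multiple. -/
theorem SimpleLcmsUpTo.hasSimpleLcm_of_conGen {n : ℕ} (H : SimpleLcmsUpTo cs n)
    {x y : FreeMonoid B} (hxy : ConGen.Rel M.artinRel x y) (l r : List B)
    (hn : (l ++ x.toList ++ r).length ≤ n + 1) {i j : B} {ω τ : List B}
    (hx : l ++ x.toList ++ r = i :: ω) (hy : l ++ y.toList ++ r = j :: τ) :
    HasSimpleLcm cs i (ofWord M ω) j (ofWord M τ) := by
  have word : ∀ {x y : FreeMonoid B}, ConGen.Rel M.artinRel x y →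
      ofWord M x.toList = ofWord M y.toList := fun h => PresentedMonoid.mk_eq_mk_iff.2 h
  have len : ∀ {x y : FreeMonoid B}, ConGen.Rel M.artinRel x y →
      x.toList.length = y.toList.length := fun h => by
    have := congrArg length (word h)
    rwa [length_ofWord, length_ofWord] at this
  induction hxy generalizing l r i j ω τ with
  | refl x =>
    rw [hx] at hy
    obtain ⟨rfl, rfl⟩ := List.cons.inj hy
    exact hasSimpleLcm_refl _ _
  | symm h ih => exact (ih l r (by simpa [len h] using hn) hy hx).symm
  | @trans x z y h h' ih ih' =>
    have hz : (l ++ z.toList ++ r).length = (i :: ω).length := by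
      rw [← hx]
      simp [len h]
    obtain ⟨k, ρ, hρ⟩ := List.exists_cons_of_ne_nil
      (List.ne_nil_of_length_pos (by rw [hz]; simp) : l ++ z.toList ++ r ≠ [])
    refine H.hasSimpleLcm_trans ?_ (ih l r hn hx hρ) (ih' l r ?_ hρ hy)
    · rw [hx, ← hz, hρ] at hn
      simpa using hn
    · rwa [hz, ← hx]
  | @mul x y z t h h' ih ih' =>
    rw [FreeMonoid.toList_mul] at hx hy hn
    have hz : (l ++ (y.toList ++ z.toList) ++ r).length = (i :: ω).length := by
      rw [← hx]
      simp [len h]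
    obtain ⟨k, ρ, hρ⟩ := List.exists_cons_of_ne_nil
      (List.ne_nil_of_length_pos (by rw [hz]; simp) : l ++ (y.toList ++ z.toList) ++ r ≠ [])
    refine H.hasSimpleLcm_trans (d := ofWord M ρ) (l := k) ?_
      (ih l (z.toList ++ r) (by simpa using hn) (by simpa using hx) (by simpa using hρ))
      (ih' (l ++ y.toList) r ?_ (by simpa using hρ) (by simpa using hy))
    · rw [hx, ← hz, hρ] at hn
      simpa using hn
    · rw [hx, ← hz] at hn
      simpa using hn
  | of x y h =>
    have hw := word (ConGen.Rel.of x y h)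
    rcases l with _ | ⟨k, l⟩
    · obtain ⟨s, t, hm, rfl, rfl⟩ := h
      rw [List.nil_append] at hx hy
      rw [FreeMonoid.toList_ofList] at hx hy
      by_cases hst : s = t
      · subst hst
        rw [hx] at hy
        obtain ⟨rfl, rfl⟩ := List.cons.inj hy
        exact hasSimpleLcm_refl _ _
      obtain ⟨m, hm⟩ := Nat.exists_eq_succ_of_ne_zero hm
      have key : ∀ {s t : B}, s ≠ t → M s t = m + 1 → altFrom s t (m + 1) ++ r = i :: ω →
          altFrom t s (m + 1) ++ r = j :: τ →
          HasSimpleLcm cs i (ofWord M ω) j (ofWord M τ) := by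
        intro s t hst hm hx hy
        obtain ⟨rfl, rfl⟩ := List.cons.inj hx
        obtain ⟨rfl, rfl⟩ := List.cons.inj hy
        exact hasSimpleLcm_braid cs hst hm r
      rw [hm] at hx hy
      have e1 := altFrom_eq_alternatingWord s t (m + 1)
      have e2 := altFrom_eq_alternatingWord t s (m + 1)
      by_cases he : Even (m + 1)
      · rw [if_pos he] at e1 e2
        exact key hst hm (by rwa [e1]) (by rwa [e2])
      · rw [if_neg he] at e1 e2
        exact key (Ne.symm hst) (by rwa [M.symmetric]) (by rwa [e2]) (by rwa [e1])
    · rw [List.cons_append, List.cons_append, List.cons.injEq] at hx hy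
      obtain ⟨rfl, rfl⟩ := hx
      obtain ⟨rfl, rfl⟩ := hy
      simp only [ofWord_append, hw]
      exact hasSimpleLcm_refl _ _

variable (cs) in
theorem simpleLcmsUpTo (n : ℕ) : SimpleLcmsUpTo cs n := by
  induction n with
  | zero => exact fun i j a b h => absurd h (Nat.not_lt_zero _)
  | succ n H =>
    intro i j a b hn h
    obtain ⟨ω, rfl⟩ := ofWord_surjective M a
    obtain ⟨τ, rfl⟩ := ofWord_surjective M b
    rw [← ofWord_cons, ← ofWord_cons] at h
    refine H.hasSimpleLcm_of_conGen (PresentedMonoid.mk_eq_mk_iff.1 h) [] [] ?_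
      (i := i) (j := j) (by simp) (by simp)
    simpa using hn

/-- Artin monoids are left cancellative. -/
theorem mul_left_cancel (c : ArtinMonoid M) {a b : ArtinMonoid M} (h : c * a = c * b) : a = b :=
  (simpleLcmsUpTo M.toCoxeterSystem _).cancel c le_rfl h

end ArtinMonoid

/-! ### Garside elements as lifts of longest elements. -/

namespace ArtinMonoid

open CoxeterSystem

section General

variable {B : Type*} {M : CoxeterMatrix B}

theorem IsGarsideElement.unique {D D' : ArtinMonoid M} (h : IsGarsideElement D)
    (h' : IsGarsideElement D') : D = D' := by
  obtain ⟨r, hr⟩ := h.2 D' h'.1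
  obtain ⟨s, hs⟩ := h'.2 D h.1
  have h1 := congrArg length hr
  have h2 := congrArg length hs
  rw [length_mul] at h1 h2
  rw [hr, eq_one_of_length_eq_zero (show length r = 0 by omega), mul_one]

theorem gen_injective (M : CoxeterMatrix B) : Function.Injective (gen M) := fun _ _ h =>
  M.toCoxeterSystem.simple_injective (congrArg (toGroup M.toCoxeterSystem) h)

theorem IsSquareFree.of_mul_left {a b : ArtinMonoid M} (h : IsSquareFree (a * b)) :
    IsSquareFree b := by
  rintro i ⟨l, r, rfl⟩
  exact h i ⟨a * l, r, by simp only [mul_assoc]⟩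

/-- The indicator of not containing the generator `k`. -/
def avoidHom [DecidableEq B] (M : CoxeterMatrix B) (k : B) : ArtinMonoid M →* ℕ :=
  PresentedMonoid.lift (fun i => if i = k then 0 else 1) (by
    rintro _ _ ⟨s, t, hm, rfl, rfl⟩
    rcases eq_or_ne s t with rfl | hst
    · rfl
    -- Off the diagonal a finite label is at least 2, so both sides of the relation contain both
    -- letters.
    obtain ⟨m, hm⟩ : ∃ m, M s t = m + 1 + 1 :=
      ⟨M s t - 2, by have := M.off_diagonal s t hst; omega⟩
    rw [FreeMonoid.lift_ofList, FreeMonoid.lift_ofList, hm]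
    by_cases hk : s = k ∨ t = k
    · have h0 : ∀ a b : B, (a = k ∨ b = k) →
          ((alternatingWord a b (m + 1 + 1)).map fun i => if i = k then 0 else 1).prod = 0 := by
        intro a b hab
        rw [alternatingWord_succ, alternatingWord_succ]
        rcases hab with rfl | rfl <;> simp
      rw [h0 s t hk, h0 t s hk.symm]
    · push Not at hk
      have h1 : ∀ (a b : B) (m : ℕ), a ≠ k → b ≠ k →
          ((alternatingWord a b m).map fun i => if i = k then 0 else 1).prod = 1 := by
        intro a b m
        induction m generalizing a b with
        | zero => simp [alternatingWord]
        | succ m ih =>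
          intro ha hb
          rw [alternatingWord_succ, List.concat_eq_append, List.map_append, List.prod_append,
            ih b a hb ha]
          simp [hb]
      rw [h1 s t _ hk.1 hk.2, h1 t s _ hk.2 hk.1])

@[simp]
theorem avoidHom_gen [DecidableEq B] (k i : B) :
    avoidHom M k (gen M i) = if i = k then 0 else 1 := rfl

variable {W : Type*} [Group W] (cs : CoxeterSystem M W)

/-- A square of a generator dies in W, which would give `w` a word two letters shorter than its
length. -/
theorem isSquareFree_simpleLift (w : W) : IsSquareFree (simpleLift cs w) := by
  rintro i ⟨l, r, h⟩
  obtain ⟨ω, rfl⟩ := ofWord_surjective M l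
  obtain ⟨τ, rfl⟩ := ofWord_surjective M r
  have h1 := congrArg length h
  have h2 := congrArg (toGroup cs) h
  simp only [length_simpleLift, pow_two, length_mul, length_ofWord, length_gen] at h1
  simp only [toGroup_simpleLift, map_mul, pow_two, toGroup_ofWord, toGroup_gen,
    simple_mul_simple_self, mul_one, ← wordProd_append] at h2
  have h3 := cs.length_wordProd_le (ω ++ τ)
  rw [← h2, List.length_append] at h3
  omega

theorem isGarsideElement_simpleLift [Finite W] {x : W} (hx : ∀ i, cs.IsLeftDescent x i) :
    IsGarsideElement (simpleLift cs x) := by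
  refine ⟨fun i => ⟨_, simpleLift_eq_gen_mul cs (hx i)⟩, fun w hw => ?_⟩
  have h1 : IsSimpleDivisor cs 1 w 1 := ⟨by simp, w, by rw [simpleLift_one, one_mul]⟩
  -- By directedness a longest simple divisor `y` of `w` lies above every `s_i`. So it has all left
  -- descents, and `x` is a prefix of it.
  obtain ⟨y, hy, hmax⟩ := Set.exists_max_image {v | IsSimpleDivisor cs 1 w v} cs.length
    (Set.toFinite _) ⟨1, h1⟩
  have hdesc : ∀ i, cs.IsLeftDescent y i := by
    intro i
    have hi : IsSimpleDivisor cs 1 w (cs.simple i) :=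
      ⟨by simp, by rw [simpleLift_simple]; exact hw i⟩
    obtain ⟨z, hz, hyz, hiz⟩ := (simpleLcmsUpTo cs _).directed le_rfl hy hi
      (isPrefix_one _) (isPrefix_one _)
    have hle := hmax z hz
    rw [IsPrefix] at hyz hiz
    obtain rfl : y = z := inv_mul_eq_one.1 (cs.length_eq_zero_iff.1 (by omega))
    rw [inv_simple, length_simple] at hiz
    rw [isLeftDescent_iff]
    omega
  exact (IsSimpleDivisor.of_isPrefix hy
    (cs.length_inv_mul_of_forall_isLeftDescent hdesc x)).2

theorem exists_perm_gen_mul_simpleLift [Finite B] {x : W} (hx : ∀ i, cs.IsLeftDescent x i) :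
    ∃ τ : Equiv.Perm B, ∀ i, gen M i * simpleLift cs x = simpleLift cs x * gen M (τ i) := by
  choose τ hτ using cs.exists_simple_conj hx
  have hinj : Function.Injective τ := by
    intro i j h
    apply cs.simple_injective
    rw [← mul_left_inj x, hτ, hτ, h]
  refine ⟨Equiv.ofBijective τ (Finite.injective_iff_bijective.1 hinj), fun i => ?_⟩
  have h1 : cs.simple i * x * cs.simple (τ i) = x := by
    rw [hτ, simple_mul_simple_cancel_right]
  have h2 : ¬ cs.IsRightDescent (cs.simple i * x) (τ i) := by
    rw [not_isRightDescent_iff, h1]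
    exact (cs.isLeftDescent_iff.1 (hx i)).symm
  have h3 := simpleLift_mul_simple cs h2
  rw [h1] at h3
  rw [Equiv.ofBijective_apply]
  conv_lhs => rw [h3]
  rw [← mul_assoc, ← simpleLift_eq_gen_mul cs (hx i)]

theorem incl_ofWord {B' : Type*} (f : B' ↪ B) (ω : List B') :
    incl M f (ofWord (M.restrict f) ω) = ofWord M (ω.map f) :=
  lift_gen_ofList M f ω

/-- Simple elements stay simple in the larger monoid because reduced words of the subgraph stay
reduced. -/
theorem exists_incl_simpleLift_eq {B' W' : Type*} [Group W'] (f : B' ↪ B)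
    (cs' : CoxeterSystem (M.restrict f) W') (w' : W') :
    ∃ w, incl M f (simpleLift cs' w') = simpleLift cs w := by
  obtain ⟨ω, hω, rfl⟩ := cs'.exists_isReduced w'
  refine ⟨cs.wordProd (ω.map f), ?_⟩
  rw [simpleLift_wordProd cs' hω, incl_ofWord, simpleLift_wordProd cs (isReduced_map cs f cs' hω)]

theorem avoidHom_incl [DecidableEq B] {B' : Type*} (f : B' ↪ B) {k : B} (hk : k ∉ Set.range f)
    (a : ArtinMonoid (M.restrict f)) : avoidHom M k (incl M f a) = 1 := by
  obtain ⟨ω, rfl⟩ := ofWord_surjective _ a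
  induction ω with
  | nil => simp [ofWord_nil]
  | cons i ω ih =>
    rw [ofWord_cons, map_mul, map_mul, ih, incl_gen, avoidHom_gen,
      if_neg (fun h => hk ⟨i, h⟩)]

end General

section Finite

variable {B : Type*} {M : CoxeterMatrix B} [Finite M.Group]

theorem exists_eq_simpleLift_of_isGarsideElement {D : ArtinMonoid M} (hD : IsGarsideElement D) :
    ∃ x, (∀ i, M.toCoxeterSystem.IsLeftDescent x i) ∧ D = simpleLift M.toCoxeterSystem x := by
  obtain ⟨x, hx⟩ := M.toCoxeterSystem.exists_forall_isLeftDescent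
  exact ⟨x, hx, hD.unique (isGarsideElement_simpleLift _ hx)⟩

theorem existsUnique_isGarsideElement (M : CoxeterMatrix B) [Finite M.Group] :
    ∃! D : ArtinMonoid M, IsGarsideElement D := by
  obtain ⟨x, hx⟩ := M.toCoxeterSystem.exists_forall_isLeftDescent
  exact ⟨_, isGarsideElement_simpleLift _ hx,
    fun D hD => hD.unique (isGarsideElement_simpleLift _ hx)⟩

theorem IsGarsideElement.isSquareFree {D : ArtinMonoid M} (hD : IsGarsideElement D) :
    IsSquareFree D := by
  obtain ⟨x, -, rfl⟩ := exists_eq_simpleLift_of_isGarsideElement hD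
  exact isSquareFree_simpleLift _ x

theorem IsGarsideElement.exists_perm [Finite B] {D : ArtinMonoid M} (hD : IsGarsideElement D) :
    ∃ τ : Equiv.Perm B, ∀ i, gen M i * D = D * gen M (τ i) := by
  obtain ⟨x, hx, rfl⟩ := exists_eq_simpleLift_of_isGarsideElement hD
  exact exists_perm_gen_mul_simpleLift _ hx

theorem IsGarsideElement.exists_eq_incl_mul {B' : Type*} {f : B' ↪ B}
    [Finite (M.restrict f).Group] {D' : ArtinMonoid (M.restrict f)} {D : ArtinMonoid M}
    (hD' : IsGarsideElement D') (hD : IsGarsideElement D) : ∃ R, D = incl M f D' * R := by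
  obtain ⟨x', hx', rfl⟩ := exists_eq_simpleLift_of_isGarsideElement hD'
  obtain ⟨x, hx, rfl⟩ := exists_eq_simpleLift_of_isGarsideElement hD
  obtain ⟨w, hw⟩ := exists_incl_simpleLift_eq M.toCoxeterSystem f _ x'
  rw [hw]
  exact ⟨_, simpleLift_eq_of_isPrefix _
    (M.toCoxeterSystem.length_inv_mul_of_forall_isLeftDescent hx w)⟩

end Finite

end ArtinMonoid

/-! ### The relative Garside element. -/

open ArtinMonoid in
theorem proposition1 (n : ℕ) (M : CoxeterMatrix (Fin (n + 1)))
    (hM : Finite M.Group)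
    (hM' : Finite (M.restrict (Fin.castSuccEmb : Fin n ↪ Fin (n + 1))).Group) :
    -- the Garside elements of the two graphs exist and are unique
    (∃! D' : ArtinMonoid (M.restrict (Fin.castSuccEmb : Fin n ↪ Fin (n + 1))),
      ArtinMonoid.IsGarsideElement D') ∧
    (∃! D : ArtinMonoid M, ArtinMonoid.IsGarsideElement D) ∧
    ∀ (D' : ArtinMonoid (M.restrict (Fin.castSuccEmb : Fin n ↪ Fin (n + 1))))
      (D : ArtinMonoid M),
      ArtinMonoid.IsGarsideElement D' → ArtinMonoid.IsGarsideElement D →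
      -- the relative Garside element and the permutation of the larger graph are well defined
      (∃! R : ArtinMonoid M, D = ArtinMonoid.incl M Fin.castSuccEmb D' * R) ∧
      (∃! τ : Equiv.Perm (Fin (n + 1)),
        ∀ i, ArtinMonoid.gen M i * D = D * ArtinMonoid.gen M (τ i)) ∧
      ∀ (R : ArtinMonoid M) (τ : Equiv.Perm (Fin (n + 1))),
        D = ArtinMonoid.incl M Fin.castSuccEmb D' * R →
        (∀ i, ArtinMonoid.gen M i * D = D * ArtinMonoid.gen M (τ i)) →
        ArtinMonoid.IsSquareFree R ∧
        (∀ i, ArtinMonoid.LeftDvd (ArtinMonoid.gen M i) R ↔ i = Fin.last n) ∧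
        (∃ σ : Fin n ≃ {j : Fin (n + 1) // j ≠ τ (Fin.last n)},
          ∀ i : Fin n, ArtinMonoid.gen M i.castSucc * R =
            R * ArtinMonoid.gen M (σ i : Fin (n + 1))) ∧
        (∀ j, ArtinMonoid.RightDvd (ArtinMonoid.gen M j) R ↔ j = τ (Fin.last n)) := by
  refine ⟨existsUnique_isGarsideElement _, existsUnique_isGarsideElement _,
    fun D' D hD' hD => ⟨?_, ?_, fun R τ hR hτ => ?_⟩⟩
  · obtain ⟨R, hR⟩ := hD'.exists_eq_incl_mul hD
    exact ⟨R, hR, fun S hS => ArtinMonoid.mul_left_cancel _ (hS.symm.trans hR)⟩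
  · obtain ⟨τ, hτ⟩ := hD.exists_perm
    refine ⟨τ, hτ, fun ρ hρ => Equiv.ext fun i => gen_injective M ?_⟩
    exact ArtinMonoid.mul_left_cancel D ((hρ i).symm.trans (hτ i))
  have hsq := hD.isSquareFree
  obtain ⟨ρ, hρ⟩ := hD'.exists_perm
  set E := incl M Fin.castSuccEmb D' with hE
  have hρE : ∀ i : Fin n, gen M i.castSucc * E = E * gen M (ρ i).castSucc := fun i => by
    have h := congrArg (incl M Fin.castSuccEmb) (hρ i)
    rwa [map_mul, map_mul] at h
  -- E starts with every letter of the subgraph; conjugation by E turns first letters into last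
  -- letters.
  have hEend : ∀ i : Fin n, ∃ F, E = F * gen M i.castSucc := by
    intro i
    obtain ⟨F, hF⟩ := hD'.1 (ρ.symm i)
    refine ⟨incl M Fin.castSuccEmb F, ?_⟩
    have h1 := hρE (ρ.symm i)
    rw [Equiv.apply_symm_apply] at h1
    apply ArtinMonoid.mul_left_cancel (gen M (ρ.symm i).castSucc)
    have h2 : E = gen M (ρ.symm i).castSucc * incl M Fin.castSuccEmb F := by
      rw [hE, hF, map_mul, incl_gen]
      rfl
    rw [h1, ← mul_assoc, ← h2]
  -- Otherwise Δ = E would be divisible by the last generator, which `avoidHom` detects.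
  have hR1 : R ≠ 1 := by
    rintro rfl
    obtain ⟨r, hr⟩ := hD.1 (Fin.last n)
    have h1 := congrArg (avoidHom M (Fin.last n)) hr
    rw [hR, mul_one, hE, avoidHom_incl _ (by simp)] at h1
    simp at h1
  have hconj : ∀ i : Fin n, gen M i.castSucc * R = R * gen M (τ (ρ.symm i).castSucc) := by
    intro i
    apply ArtinMonoid.mul_left_cancel E
    have h1 := hρE (ρ.symm i)
    rw [Equiv.apply_symm_apply] at h1
    rw [← mul_assoc, ← h1, mul_assoc, ← hR, hτ, hR, mul_assoc]
  have hnot_left : ∀ i : Fin n, ¬ LeftDvd (gen M i.castSucc) R := by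
    rintro i ⟨r, hr⟩
    obtain ⟨F, hF⟩ := hEend i
    exact hsq i.castSucc ⟨F, r, by rw [hR, hF, hr]; simp only [pow_two, mul_assoc]⟩
  -- A last letter of E, chosen as `ρ i`, passes through R and becomes `τ i`; if R already ended in
  -- `τ i`, Δ would contain its square.
  have hnot_right : ∀ i : Fin n, ¬ ArtinMonoid.RightDvd (gen M (τ i.castSucc)) R := by
    rintro i ⟨l, hl⟩
    obtain ⟨F, hF⟩ := hEend (ρ i)
    have h1 := hconj (ρ i)
    rw [Equiv.symm_apply_apply] at h1
    refine hsq (τ i.castSucc) ⟨F * l, 1, ?_⟩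
    rw [hR, hF, mul_assoc, h1]
    conv_lhs => rw [hl]
    simp only [pow_two, mul_assoc, mul_one]
  refine ⟨IsSquareFree.of_mul_left (hR ▸ hsq), fun i => ⟨fun h => ?_, ?_⟩,
    -- The bijection is `τ ∘ ρ⁻¹`, as in `hconj`; its image misses exactly `τ (Fin.last n)`.
    ⟨ρ.symm.trans ((finSuccAboveEquiv (Fin.last n)).trans
      (τ.subtypeEquiv fun a => by simp)), fun i => ?_⟩, fun j => ⟨fun h => ?_, ?_⟩⟩
  · by_contra hi
    obtain ⟨k, rfl⟩ := Fin.exists_castSucc_eq.2 hi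
    exact hnot_left k h
  · rintro rfl
    obtain ⟨k, r, hr⟩ := exists_eq_gen_mul hR1
    induction k using Fin.lastCases with
    | last => exact ⟨r, hr⟩
    | cast k => exact absurd ⟨r, hr⟩ (hnot_left k)
  · simpa [finSuccAboveEquiv_apply] using hconj i
  · by_contra hj
    obtain ⟨k, hk⟩ := Fin.exists_castSucc_eq.2 (show τ.symm j ≠ Fin.last n by
      rwa [Ne, Equiv.symm_apply_eq])
    apply hnot_right k
    rwa [hk, Equiv.apply_symm_apply]
  · rintro rfl
    obtain ⟨k, r, hr⟩ := exists_eq_mul_gen hR1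
    obtain ⟨k, rfl⟩ := τ.surjective k
    induction k using Fin.lastCases with
    | last => exact ⟨r, hr⟩
    | cast k => exact absurd ⟨r, hr⟩ (hnot_right k)
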